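/- Let $\Gamma=\mathrm{SL}(3,\mathbb Z)$ and let $S\subset\Gamma$ be the set of the $12$ elementary matrices obtained from $1+E_{12},\ 1+E_{13},\ 1+E_{23}$ by closing up under transposes and inverses, i.e. $S=\{1\pm E_{ij} : i\neq j\}$. In the real group algebra $\mathbb R[\Gamma]$, with the involution $\left(\sum_g c_g g\right)^*=\sum_g c_g g^{-1}$, put $$\Delta = 12-\sum_{s\in S}s .$$ Then the following hold. (1) There are $n\le 121$ and $b_1,\dots,b_n\in\mathbb R[\Gamma]$, each a linear combination of at most $121$ group elements, all of which are products of at most two elements of $S$, such that $$\Delta^2-\tfrac16\,\Delta=\sum_{i=1}^n b_i^*b_i .$$ (2) $\Gamma$ has Kazhdan's property (T): there are a finite set $K\subset\Gamma$ and $\varepsilon>0$ such that every unitary representation $\pi$ of $\Gamma$ on a complex Hilbert space $H$ having a vector $\xi\ne0$ with $\|\pi(g)\xi-\xi\|<\varepsilon\|\xi\|$ for all $g\in K$ has a nonzero $\Gamma$-invariant vector. (3) For every unitary representation $\pi$ of $\Gamma$ on a complex Hilbert space, extended linearly to $\mathbb R[\Gamma]$, one has $\mathrm{sp}(\pi(\Delta))\subset\{0\}\cup[\tfrac16,\infty)$,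 and the random walk operator $\pi\big(\tfrac1{12}\sum_{s\in S}s\big)$ has spectrum contained in $[-1,1-\tfrac1{72}]\cup\{1\}$. -/

import Mathlib

universe w

noncomputable section

open scoped MatrixGroups

/-- The involution `(∑ c_g g)^* = ∑ c_g g⁻¹` on the real group algebra `ℝ[Γ]`. -/
def groupAlgebraStar {Γ : Type*} [Group Γ] (x : MonoidAlgebra ℝ Γ) : MonoidAlgebra ℝ Γ :=
  x.coeff.sum fun g c => MonoidAlgebra.single g⁻¹ c

/-- The unnormalized Laplace operator `Δ = |S| - ∑_{s ∈ S} s` in `ℝ[Γ]`. -/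
def laplaceElement {Γ : Type*} [Group Γ] (S : Finset Γ) : MonoidAlgebra ℝ Γ :=
  algebraMap ℝ (MonoidAlgebra ℝ Γ) (S.card : ℝ) - ∑ s ∈ S, MonoidAlgebra.single s (1 : ℝ)

/-- The random walk element `(1 / |S|) ∑_{s ∈ S} s` in `ℝ[Γ]`. -/
def randomWalkElement {Γ : Type*} [Group Γ] (S : Finset Γ) : MonoidAlgebra ℝ Γ :=
  (1 / (S.card : ℝ)) • ∑ s ∈ S, MonoidAlgebra.single s (1 : ℝ)

/-- The group elements that are products of at most `k` elements of `S`. -/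
def wordBall {Γ : Type*} [Group Γ] (S : Finset Γ) (k : ℕ) : Set Γ :=
  {g | ∃ l : List Γ, l.length ≤ k ∧ (∀ s ∈ l, s ∈ S) ∧ l.prod = g}

/-- The operator `π(x) = ∑ c_g π(g)` given by a unitary representation `π` and `x = ∑ c_g g`. -/
def unitaryRepOperator {Γ : Type*} [Group Γ] {H : Type*} [NormedAddCommGroup H]
    [InnerProductSpace ℂ H] [CompleteSpace H] (π : Γ →* unitary (H →L[ℂ] H))
    (x : MonoidAlgebra ℝ Γ) : H →L[ℂ] H :=
  MonoidAlgebra.lift ℝ (H →L[ℂ] H) Γ ((unitary (H →L[ℂ] H)).subtype.comp π) x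

/-- Kazhdan's property (T) for a discrete group `Γ`: there are a finite set `K ⊆ Γ` and `ε > 0` such
that every unitary representation of `Γ` on a complex Hilbert space that has a `(K, ε)`-invariant
vector has a nonzero invariant vector. -/
def HasPropertyT.{u, v} (Γ : Type u) [Group Γ] : Prop :=
  ∃ (K : Finset Γ) (ε : ℝ), 0 < ε ∧
    ∀ (H : Type v) [NormedAddCommGroup H] [InnerProductSpace ℂ H] [CompleteSpace H]
      (π : Γ →* unitary (H →L[ℂ] H)),
      (∃ ξ : H, ξ ≠ 0 ∧ ∀ g ∈ K, ‖(π g : H →L[ℂ] H) ξ - ξ‖ < ε * ‖ξ‖) →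
        ∃ η : H, η ≠ 0 ∧ ∀ g : Γ, (π g : H →L[ℂ] H) η = η

/-- The three elementary matrices `1 + E₁₂`, `1 + E₁₃`, `1 + E₂₃` in `SL(3, ℤ)`. -/
def elementaryUpper : Fin 3 → SL(3, ℤ) :=
  ![⟨!![1, 1, 0; 0, 1, 0; 0, 0, 1], by decide⟩,
    ⟨!![1, 0, 1; 0, 1, 0; 0, 0, 1], by decide⟩,
    ⟨!![1, 0, 0; 0, 1, 1; 0, 0, 1], by decide⟩]

/-- The generating set of `SL(3, ℤ)` obtained from `1 + E₁₂`, `1 + E₁₃`, `1 + E₂₃` by closing up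
under transposes and inverses. -/
def elementaryGenerators : Finset SL(3, ℤ) :=
  Finset.univ.image elementaryUpper ∪
    Finset.univ.image (fun i => (elementaryUpper i).transpose) ∪
    Finset.univ.image (fun i => (elementaryUpper i)⁻¹) ∪
    Finset.univ.image (fun i => (elementaryUpper i).transpose⁻¹)

theorem card_elementaryGenerators : elementaryGenerators.card = 12 := by
  decide +kernel

end

/-! Write `g_i` for the 84 words, products of at most two generators, and `Δ` for the Laplacian. A
positive semidefinite matrix `G` with `∑ G_ij (1 - g_i)^* (1 - g_j) = 6000 Δ² - 1000 Δ` turns `Δ² -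
Δ/6` into a sum of squares, by factoring `G / 6000 = Bᵀ B`. Such an integer matrix is recovered from
an approximate Cholesky factor by rounding. Positivity is then exact: `4000000 G` is the Gram matrix
of the factor plus a diagonally dominant residual (`gramMatrix_posSemidef`). The algebraic identity
(`sum_gramEntry`) is checked by expanding both sides, encoding group elements as integers, sorting,
and cancelling coefficients.

In a unitary representation, `A = π(Δ)` is positive, because `2 Δ = ∑ (1 - s)^* (1 - s)`, and the
sum of squares gives `A² ≥ A/6`. Hence every point `t` of the spectrum satisfies `t ≥ 0` and `t² ≥
t/6`; the random walk operator is `1 - A/12`. The kernel of `A` consists of the vectors fixed by the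
elementary matrices, hence by the group they generate, which is all of `SL(3, ℤ)`. Without invariant
vectors `A` is therefore injective, so `A ≥ 1/6` (`mul_norm_sq_le_inner_of_injective`), which rules
out almost invariant vectors. -/

noncomputable section

open scoped MatrixGroups

/-! ### Numerical data of the certificate. -/

/-- The rows of a lower triangular integer matrix, an approximate Cholesky factor of the Gram matrix.
Each row is a number with digits in base `10 ^ 6`, lowest digit first, and a digit `n` stands for
the entry `n - 500000`. -/
def cholData : List ℕ :=
  [642197,
   642141503994,
   640403491980478959,
   626766512257454347456230,
   625826439493497827520680517159,
   641004496563498070495547517073503319,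
   610191440859519461538494511581453708478959,
   625574502294501934502304497731497884433751506189,
   608106518589486292511990496541474863436744556600502700,
   631868499136477859462418516673492238476750506422502702500000,
   620494494071516371515157487886505612498393469046494596457529453135,
   619624444271495949507668458473504469498003500470512268510384516572521154,
   629281505209517570485732461704493756483045482073508274492574514900479192491392,
   619028499478506134500066500988494497508407495185499776465849516084493923508047433951,
   639378500332496555498773500175503362494026500449502539498812501077508743481424502838517159,
   608670440202502379505870517792534722493341502729494560493128502975498594477236494585480267453135,
   628811505050496447498057513136494612474207502278499951498836506287519930501387504589452537500000500000,
   617878501684504957498327453772496760520926499116486539496352499071457818531894508383513729503136499406521154,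
   610327494440451533499910499579488491526380455798528708495148502839500940503342505524459791519248500000500000500000,
   599647550026449468486160499626499743521608493676454022518983505007503673500931497067456091506847498123499133500164494149,
   603571522838462439514652521600497308500631509523449793518339485315521193492009498379524967503650512058450902500000500000500000,
   603367499758452696479798526012507162456290531650507758496429496437521084495093498474457714503669497998520901500941501209521162500000,
   606847487460528159493515459241477268500812508791508173488505502008455680524691499932507958501571497602499945457822521657521424500000500000,
   603437515933492706462300470053519238512470442464493973480634500848492597500533505186503793506547501066495904453252499492498320517379500000500000,
   586707506746537938469723509706535075482984439605498393498890454912483707504274512342499323503335502376517466499232499867456252517172499666494147500000,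
   617505515782536682502883489096471708488147500158524484497136508099499430500019496422483138500760509470503926521530500600453408499958497924499666494147500000,
   590872496455524458515316468193522992500875497474548200501857533310518326497872502017509822517047447129503475495478498822501977498904517623498026452537500000500000,
   598969495120495518505758533317438391500123536544499846506189507126504558504334521138500672450283501040496313516564495471499493510890502198491702476398500000500000500000,
   597321458927451563504452467565483528545846508569501803492187501478501301507881495895452498499805514915499678500487494753502077500518491329478875501790503723500000500000500000,
   609862536493501281474713543614479372497358501256526560498301503033492000500034498020499682452724515562502371500337498545501044500009500690506363499576477865501846499133500164494149,
   594361456900504117499105500915445658530041479888498305498632502850516969499577535157506166507356515994453009496230499285505241493364499285499404474521502618503482505505502544499518517159,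
   591131475374465148478092500595501664440142506901505502496775545352503156513795491369499803501200472875502411502011501475490552512779492922499625455773505645515343500123506087500981517166500000,
   578720527243486602513951488170493864486215449855485386510553498607495882504765488707463948511234488019489084493743493262506385569404490231527640497016506294502230498690501296504286455670500000500000,
   593027474513460417512420500196501869496155507461524182494216506685503703480363497229509298530687484923522914502719502995499162478469493221506571448580456375508334499801500237499110499105532319506191500000,
   588887519870500052500655485476508745503141489594496482484195514821471336506361490361478922488548507401513827501038498285502575501900556716496320498924440261515059504177515764455936501457503029500000500000500000,
   598924507620519328508420496248486879498137493955500401494107511018483078506250506667519788489491508175503439468047496598491788502755561365493119498036477564485732490147496834500625510930477050484415499584456454491392,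
   597415501018506990557971485344515968500600504770526132493638498460505540492980505690498412500719504582502640481881493097455192494306491336498987486185501247500793449577473300503102499862500081499920499736502735500000500000,
   584020463118500189491387493563534360504846509323475223460472516249491189515597507135465841493309481919498141495850512352503389535502520548557676501750502987493718504157515240506944477941500756499621500024501178500190503321500000,
   599824508511520646517750438716515432487650504884496972510601515369498181518882499886496607501058496491489968497616504290503894496865510840461922515349475716513985495298478543534882496627499706500550499714500323501709491683499924502700,
   586240508722499920484242490711513817519035475492504092503702503487495755509959482780501292500911496834504982491485512363494112501332497413485168484567507452518487450448494236470878508973526634497533504070501313506074530362464224501109556654,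
   567551528909482594523272487236485778517324475976512403484512507422478481470127510114475958505393484177505509501660516813509593499585483204496098468763521879465294508718493848492319498534448181520195500924497114501695498323494452557378500000500000,
   554320494357509433547666476336509855497850500221488480527650496502529987450143517477485304513302496290489333483858480813502507471743483905514795506165505068500746498788525259447080499887498059503177498897498833493592501315559382490344500000500000500000,
   534039535475542180442611417605512611493802492074484419509715490773495924456427515991503880519862496285505403505960511580503351497637519244499806489251477730497321500312500135505537535845499833503042500353501086499815501502499719490822502806500918499826506189,
   570799504120526867547757486836422069510303499597544487499312498734500725501794514750497874500706449877501489506225501092509850509009500056473509499433502889503044494845500027499898502999502116500391500275506749500457500202496285491319500000500000500000500000500000,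
   548078501353482512524816492556484515542583486387503840441976525312506207480533511373502207525764468353550599503090480456491991472665491320502773503177497748494255485164508249500777499914477544509355499785501391498304496914498574519693557098500083501065500492499907503319,
   542246517447473525500192500443543350504672468210455364552251501526497775488547496655485672499616509019506296501943489186501650519628493356509388466597491329502930504297507259492822500096511187493291502417496330472870506476485551562058496226501441498840482904493019492619456230,
   531130500706539413433945496272478716496952512221501252499890489024468289512431465147516861492850509832502837516418497368514541490596516315490996494222471893490298502081493443529244501964503269497211490311508605495176523456561658498834467000514591496477503996511431501912531554500731,
   526890484315532221511571487420481500505103477083493155582007510207446835530853487476479572498976509764489492495883496193487417501411501368482818513347481649530349509542501156490624479844502909517256496410465423501829500081515936503207506646488847501475499587500797510385504721499845531562,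
   530017491098494887479309460706508025516368477024517003500924500795496186491225486242502764514508464177493296494924499989494716507212489421499287501916495082510484501319496685498755504553501625494484547606487812480684468522513722525227497687537950474420548326494521522713521618456104511761512096,
   526787513547491027516976473371522473518127488470485836476482494850500981496863505411521982506751493704501335503159483224500045511058539845499191492783502176497975477076490799532415485812506557516373510657498382504599470112514512504261505829469800506291520493533364449726475947515143512106540473465738,
   516520521086513547502960495133492831481760488197514547522580461648506951494611501889490359519598478250510733494448496715545415486324494338493196501175489395492075503347491349519335509429529614482113521416499630501261504638508332492054503334487648472881546975525443490912472979469069533830490419509279454204,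
   516496500888502573524930510717490596528705495087499142486577468466487085480545478639508915544377477301491317523390516399494757510984501397512976485508510352505554501506506475483849477366506956498757488751502283492495497005492850491200472698489386526111520890497774470530510030510688518284555330473097540982481659,
   523752507217505542508401513547510143483696528755491237505335490540500335495139525755470010508738514725482473504139470913492940484593509045492914479597508113508088497587485215512341503237512055506604486006504780500502548931533611451256524129506222468142519845493979494637479702493218503865500387499332516148464614539494,
   515950518088505658501824510031513547497287505009506406510233501250496998492474493448544602464303462223482474469547485576518166496785543635486888494376500741494991499780483094536356493406487184516552500129492097493686513055493800488554471075526248493429472204527162499326511794520588497076504720502661492783479992453962507989,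
   511992502050499857499505505310522890514164489725511783473721506027506184498421494250527650508218506303495131492590479144497260469670523413468645481497492399490909477411494618479301499199487991471490529406516780555004532096492658503627511928483631506488512866517508442722498602527787496399497678500995504584499062508680493630506357,
   511926498257501518499318505329501588501689526818496125497774494530476310484280515750523137506873494878513093466454487373496872502268502493554394521933516719494595488455483143497780493457498013480739513401454824483858519777506308435574467979485136499186505646495048519028519374500002501377504992483583500640516979516534500000500000500000,
   512014500449498388500833500452509948500040503030525394501737494943509846526064520849477430492072499000492733504569497893479773474921503772507140502722489324495669499114487651535590516425518149467273505109514377472048454187499557543267470258449007492306497952499182510916544666496590504629503166499403526053508005496539492650504216500000500000,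
   511195498921499331501429496242502219501300510033521573513611506547490463531609504620483870498195513498491877505331485083494877535532507636498945457074512208519198473196514530473062487442468774452470482948489581488183520258509283503085548716518200475710466397498560496166503629508059476860511432483397516792505610502514500106505229500842514746500000,
   511729499783501445498840500291505502520252504440505905508017514164505001485187508451472301504337499397503407476792533219528607506080493105491091542205504453503968475703476400483485494816513894525599484316558019502239517152489194509800514744461076494646495426493134503204508705502872505718489283494597493766502534510914480651520902448900499446506534493811,
   510705500900497992503041499655499651508608519003505146499210511160513611495061510461495564527174512650475443485867483883502871517977484633505083545454493832492367523628480117525602449804502400513945526839495410514023481717552038500932482988479466467799508494504172502230504585519582491119499265496594485904491343499269466505499433499928475384502185499586514740,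
   512067500575502268499159498235504611498055504803519003500429507250507562515065499538492426493181482487475533513221520650481067510310519249480147499376485913528094508763489902521459510452501789458970544069492530544161494167533197482773488384508766481041463815497866510778497525509772495078540600500777490098503329487883499674488953511222481519461567500000500000500000,
   512386504509502942499774500171497084502550500565508399517697501517500139509497515065496731511476490813519344477827488809469492486170480888529482498213496252500144511128493248486564519633512823487099463847489181494902493859523511545860501768468918488616465837503569537725492673496398501362537227496665507127494906478518497340502857464984539967481529505244499762504255496793,
   513781499678499349498857498560500431500055502441502300503736499781501160504386520838515065493225503417496519489498503337503664484192524468507058496039496140465311494601481649496971529507514553517481542366522870512058493097517320485991460808464980494323490372493168520596504561548822493449518764504703508480475221458127500807518152496724501429507593498831496133539999500000500000,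
   512604494397502893501549500243499012502586499264503079500193499417500351504317501394504040525394496507504049490725504214482896509640517493483896484655510009541843506127494850492989486747500420492699489997519881497386473389447864510108497124470870549048462232509409475220494381458669504804526871509219513283501822495490491346499403503489499426492094497839542715495780506439500000500000,
   511669504831494472498669498845500391502909500299503188499577502416500988500511509322501663504820523851500834500479493262509633524505487871510526484710509191510153518441510997482554504745486793517723469777476721530484521762472735470370546654493207509178500795500949450506498480478971504611463751518275540308506826507624498320499597500883496648506330517852539737496249500000500000500000500000,
   511831497595496695506451499938499983499864500596502378502638500439499751497600501406501160509398519108515065508266491394519709497006488603497458488876507956499285484035517224470281496332509811460152486681517245515757496813544644509534489802484583453131460766509042544077498502495651496476495021501548466267539700501250500235494325501410507347492711542611498437500399507364500523497072496675504163,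
   510258502705499033499403499544504005506608502839504878500440499695502156497997503375518858500057504449508148515274493769521241478947507589465538510216490250507193516547470870509615506945493188547847499500462573491345504454501410514716497111561300491117491674513463502876496137490672500075520623498824522066491118468466500063480569492059488598504332465367482377501148500938502179503622540720504371496681,
   509544499963499497500137499390500722504284505915505136502532498687497777501227503113508693517097498934500373508740516101482907517258475405501596482251508984479126527472491047489370457991546349497597520174527890477361492393491158490511506865493731487303510897524460488111499760546371485801492300492753506250497944481493502440495077491058465142494359539201464550499763494042502990499813490719498505473829500000,
   509178501857503597500257503764506358493370501064500814500529500154499645502246505221497896499814499857503405500373505435524930497276513996470164515153532149506307536960500074497479500422503881492492532514482537484871472668510824492727505233509271478815518421505091483389508234487189503615496756499314494569480327504041508443505053463745464197518188557901500800494664492402496106500478494904509826470249480515540451,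
   509104501158498196497948503564497455497695508661502663500003501059498599502280498527499640505339500861500335502871503564520213515274515208483915528346496809517662489698473392529959446896506908510687482958516070488317492483491575498475489383491352508554486400491066501910501677519304481733498012570607494928489292493243502034498950501402481436532863501784502273469355496294498342489056465192495206480227494177496559504276,
   508982498514501158498817498430504229498613496594508342498899500391499575503321504474499496498608503040498160501321500189509515517691516101506295476540520081452458522873516514498928536374476333516165514699498976557175468366505383489167489925493372515062496666497228503373495410502256508437502867505572482100529198491414544448497573491466503458488738496905499585487302495092488764495413483894503641460624491607496121500735473839,
   508843501576501337498672500800500478498161504877506603494255498552498518498191499001499385504963502161498465502911500550509491503386505457523053506097503502503204524579501833509782543496478175478739486365516531491376481081441486563844494227492137492586503964506049492382515081503181492419502183487034488901503312498130496075491289506141497317493120461394500318490714504027536191484463461368497999493792498083495858504330500000500000,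
   588180502307502755502337502653494770493208504388505193507787504453487356482627486843486536506620505984499237504220466793408365490878490373472103454630505619494125527517531457505284495886555132562517489192523916503351478536474753486157444126521761506760478769516578497538479013485934514924483217482967519572509633457987484260509051454015498707474621518032498187510341485392453412502901346344423357361672510263427606326864504137362248583152,
   524679415344502307495570494999494671503832503623487315507945507509476473504692508494504083504047487824503994503051485159505331507838505922467039405548454630497756507814493087518951467535489523488154467485369896522937533526525268524577540987513862590826476574506815501867500014500104498720518577490845498942507357461538464563510900495879506542475962362030521731422702506576432289324955521764432011502418502444511189490636476603568898586989364639,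
   530103520138419601503231503858503272503715494735493256503801504717507068503985487356482627486843486536501216500705493586499361466483407474491077490584472712455621507543499841495511487484515434510584490356486842482825494152548119508590539391478736490519374342489448541330498858573420523820500754552801525643481534467035511622466198357655299419523621582457564128529870498290498922338203495531493044495110497313496258499047496919494253498011497050495837,
   519199485514481620582822494026502218499410496483500347492966504887487426478744514763503209502283506191501814502637485717486200500637504463510544467308503135503352395036513267482223524497503194507633494247515263393613424730501050446943492168557672496392520906473994543221490933479255500578495665393894518855547417438589491230480222487530503834413154526860329726437752561845492439475085527276605203515425405812542551503214489497494380510904362022518715486948,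
   517202501474475339496831582822503231495735495139498971505811506481487477508969504547475981503368507681499280498644487361502422498875484935505674509058504887466866405046455621503663506596503326522157515762476206406441511960512719445960511904513136478734492757529714413183537596479635550162465194488057453024518330367534549951316095511285446383503144549354614049509562495536498726456207520164497145499244522435492042491895564262526882346800497442495091495921496934,
   515268492077510887512807505535415344494026501279495163495802502341499079505213488097479517516897502964499432505361497293503473486433486947504906503839511911467425504178502241395036491329520417501808516596456601502373474545510758468877452322495832523263499103367520455682523337503632542133520769459280381778536013490325467174458394538049553216299596537531506018491059497353508762486238530153363516492790510029494373508822512226454078586198494574594828498868486427518341,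
   515351506263492246508912512807505535415344495234495652502234494367499202501134502154486255482228518885497444504166496588502282499739487102487899507146498822514092466769498058504238395238496059485288494873471784531903502691497869516843552833461188501038509579342902533047497530481846511020365580508710512423505998488963526699459040488945458880492009562176404212536495336981520451496481496726370179534573491111493865543131500453493067587679456377569238447434516845498831499550,
   515171497655496003509131500779476367495294582822500832494080496223501822503423504488488974500816509563474662497041495916502669500932486582498334502853485216506225511052501357467334404269456710499197500454504792424722455936543237474194510077529908453220499276505893549625434234495454504970423995482156476541565185451299548151379987520377327361495191541841617040529705474419440603530677515952481928500559452249491353527467494827506976494100411531365203544344524319495684493169516765,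
   513945501955506112503843500716510848485514481620582822495234499995502467495048493826499106498811486517482296518962500753504322500558503659495121487078487653505746497427513433466652499564504470395238485306504009414375458418568720510413508878462095474337545977564799456306501702502411520688506337369819545407522001497642527912561067516783427853537171498463316171532568509563506205488896529705586243464370509243525934517005452668455653565320347252493276494254490945489394530169499583498819,
   514913497292497781500999502405494248496302524615518662419171500832500993500842500956493521494539494858497264495912496648487923481941485985487002503846502938495805501323466813406240491296490815473382456710499988499078493773489215505627502637488942485726493061493676373507499083524479501714533056455502462987431510395428336855477631628997429562537591572796464135458204534687545710521624519354454274410826359665484151496662544282531386502299515297494778513292484715494640523992486796516951493643,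
   513333501194496091506339500999502405503081497060504346518183415344496555493318495576501505498227498937488772504109509942474746499269498111502666501426487197502401504513485195506172511322499847467370404374456503497217451578492005433963599326496318533501474484518789538789441589383459485372433615297445476652522562503065493874467748534524455135501269510233509241539480524628531133499960497262484280484070533175519179543959531363539952496682364890591163567375493182500472513666483449456411454244529987,
   513023497145506915502036500648497655496003504784500406498056493763586362496555495887496512496040493681494320497576499466499239498812487923481941485985487002504973504039496982502335466878406426491254490771473255456503456771521994425043441514426968478233350291339123599196441962465098522337398747609036476216558263508014526908496348485844531951473986493519520156469616545622495577479177504159552182519251493931498110502374578928469040518273478069471847535709538649535119517447535448528075513633531260455105]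

/-- Indices `(a, b)` such that the group elements used in the sum of squares are the products
of the `a`-th and the `b`-th entry of `generatorEntries`. -/
def words : List (ℕ × ℕ) :=
  [(7, 5), (6, 2), (8, 6), (6, 10), (10, 6), (4, 6), (6, 4), (2, 6), (6, 8), (1, 11), (7, 9),
   (9, 7), (11, 7), (5, 7), (3, 7), (7, 3), (8, 4), (5, 9), (9, 11), (9, 5), (11, 9), (2, 10),
   (10, 8), (4, 8), (10, 2), (4, 2), (8, 10), (11, 3), (3, 11), (3, 5), (5, 3), (2, 4), (9, 1),
   (1, 9), (11, 1), (5, 1), (1, 3), (3, 1), (0, 8), (7, 11), (8, 0), (10, 0), (0, 10), (0, 4),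
   (4, 0), (2, 0), (1, 5), (0, 2), (6, 7), (6, 11), (5, 6), (1, 6), (7, 8), (2, 7), (8, 9),
   (9, 10), (4, 9), (2, 9), (10, 11), (5, 10), (4, 11), (4, 5), (3, 8), (3, 10), (3, 4), (2, 3),
   (1, 8), (1, 2), (0, 7), (0, 11), (0, 5), (0, 1), (6, 12), (7, 12), (9, 12), (8, 12), (10, 12),
   (11, 12), (5, 12), (4, 12), (2, 12), (3, 12), (1, 12), (0, 12)]

/-! ### Integer arithmetic for the kernel and the Gram matrix. -/

/-- `f n`, written so that the kernel evaluates `n` before it substitutes it into `f`. -/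
def forceNat {α : Type} (n : ℕ) (f : ℕ → α) : α :=
  Nat.rec (f 0) (fun m _ => f m.succ) n

/-- `f z`, written so that the kernel evaluates `z` before it substitutes it into `f`. -/
def forceInt {α : Type} (z : ℤ) (f : ℤ → α) : α :=
  match z with
  | Int.ofNat n => forceNat n fun m => f (Int.ofNat m)
  | Int.negSucc n => forceNat n fun m => f (Int.negSucc m)

/-- The sum of `c` and of `f k` for `k < n`. -/
def rangeSum (f : ℕ → ℤ) : ℕ → ℤ → ℤ
  | 0, c => c
  | n + 1, c => forceInt (c + f n) (rangeSum f n)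

/-- The sum of `c` and of the scalar product of two integer vectors, truncated to the shorter one. -/
def listDot : List ℤ → List ℤ → ℤ → ℤ
  | a :: l, b :: m, c => forceInt (a * b + c) (listDot l m)
  | [], _, c => c
  | _ :: _, [], c => c

/-- The first `k` entries of the row given by the number `n`. -/
def decodeRow : ℕ → ℕ → List ℤ
  | 0, _ => []
  | k + 1, n => forceInt (Int.ofNat (n % 1000000) - 500000) fun z =>
    forceNat (n / 1000000) fun m => z :: decodeRow k m

def cholRow (i : ℕ) : List ℤ := decodeRow (i + 1) (cholData.getD i 0)

def cholGram (i j : ℕ) : ℤ :=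
  bif i.ble j then listDot (cholRow i) (cholRow j) 0 else listDot (cholRow j) (cholRow i) 0

/-- The integer Gram matrix of the sum of squares. -/
def gramEntry (i j : ℕ) : ℤ :=
  -- Rounding to the nearest integer; the stored factor is scaled by 2000. The 3 on the diagonal
  -- gives `gramResidual` a diagonal of about 12000000, which has to dominate the errors off the
  -- diagonal.
  (cholGram i j + 2000000) / 4000000 + bif i.beq j then 3 else 0

/-- The difference between the Gram matrix and its approximate Cholesky decomposition. -/
def gramResidual (i j : ℕ) : ℤ := 4000000 * gramEntry i j - cholGram i j

/-! ### Matrices and their integer codes. -/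

/-- Entries of a `3 × 3` integer matrix, row by row. -/
structure Entries where
  (a b c d e f g h i : ℤ)
  deriving DecidableEq

namespace Entries

def mul (x y : Entries) : Entries where
  a := x.a * y.a + x.b * y.d + x.c * y.g
  b := x.a * y.b + x.b * y.e + x.c * y.h
  c := x.a * y.c + x.b * y.f + x.c * y.i
  d := x.d * y.a + x.e * y.d + x.f * y.g
  e := x.d * y.b + x.e * y.e + x.f * y.h
  f := x.d * y.c + x.e * y.f + x.f * y.i
  g := x.g * y.a + x.h * y.d + x.i * y.g
  h := x.g * y.b + x.h * y.e + x.i * y.h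
  i := x.g * y.c + x.h * y.f + x.i * y.i

def adj (x : Entries) : Entries where
  a := x.e * x.i - x.f * x.h
  b := x.c * x.h - x.b * x.i
  c := x.b * x.f - x.c * x.e
  d := x.f * x.g - x.d * x.i
  e := x.a * x.i - x.c * x.g
  f := x.c * x.d - x.a * x.f
  g := x.d * x.h - x.e * x.g
  h := x.b * x.g - x.a * x.h
  i := x.a * x.e - x.b * x.d

/-- The entries read as digits in base `7`. -/
def code (x : Entries) : ℤ :=
  -- The final constant is `3 (1 + 7 + ... + 7^8)`: it shifts digits between -3 and 3 to digits
  -- between 0 and 6.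
  x.a * 5764801 + x.b * 823543 + x.c * 117649 + x.d * 16807 + x.e * 2401 + x.f * 343 +
    x.g * 49 + x.h * 7 + x.i + 20176803

/-- Each row of a product is a combination of the rows of the second factor, so `mulCode` can
combine row codes instead of computing nine entries. -/
def rowCode (a b c : ℤ) : ℤ := a * 49 + b * 7 + c

/-- The code of the product of two matrices. -/
def mulCode (x y : Entries) : ℤ :=
  (x.a * rowCode y.a y.b y.c + x.b * rowCode y.d y.e y.f + x.c * rowCode y.g y.h y.i) * 117649 +
  (x.d * rowCode y.a y.b y.c + x.e * rowCode y.d y.e y.f + x.f * rowCode y.g y.h y.i) * 343 +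
  (x.g * rowCode y.a y.b y.c + x.h * rowCode y.d y.e y.f + x.i * rowCode y.g y.h y.i) +
  20176803

end Entries

/-- The entries of the elementary matrices and of the identity. -/
def generatorEntries : List Entries :=
  [⟨1, 1, 0, 0, 1, 0, 0, 0, 1⟩, ⟨1, 0, 1, 0, 1, 0, 0, 0, 1⟩, ⟨1, 0, 0, 0, 1, 1, 0, 0, 1⟩,
   ⟨1, 0, 0, 1, 1, 0, 0, 0, 1⟩, ⟨1, 0, 0, 0, 1, 0, 1, 0, 1⟩, ⟨1, 0, 0, 0, 1, 0, 0, 1, 1⟩,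
   ⟨1, -1, 0, 0, 1, 0, 0, 0, 1⟩, ⟨1, 0, -1, 0, 1, 0, 0, 0, 1⟩, ⟨1, 0, 0, 0, 1, -1, 0, 0, 1⟩,
   ⟨1, 0, 0, -1, 1, 0, 0, 0, 1⟩, ⟨1, 0, 0, 0, 1, 0, -1, 0, 1⟩, ⟨1, 0, 0, 0, 1, 0, 0, -1, 1⟩,
   ⟨1, 0, 0, 0, 1, 0, 0, 0, 1⟩]

def generatorEntry (a : ℕ) : Entries := generatorEntries.getD a ⟨1, 0, 0, 0, 1, 0, 0, 0, 1⟩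

/-- Index 12 is the identity, so the pairs `(a, 12)` closing `words`, at positions 72 to 83, are the
generators themselves. -/
def wordEntry (i : ℕ) : Entries :=
  (generatorEntry (words.getD i (12, 12)).1).mul (generatorEntry (words.getD i (12, 12)).2)

/-! ### The Boolean check of the group algebra identity. -/

/-- Merging two lists of pairs along their second components. -/
def mergePairs : List (ℤ × ℕ) → List (ℤ × ℕ) → List (ℤ × ℕ)
  | [], m => m
  | a :: l, m => mergeInto a l (mergePairs l) m
where
  mergeInto (a : ℤ × ℕ) (l : List (ℤ × ℕ)) (f : List (ℤ × ℕ) → List (ℤ × ℕ)) :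
      List (ℤ × ℕ) → List (ℤ × ℕ)
  | [] => a :: l
  | b :: m =>
    bif a.2.ble b.2 then a :: f (b :: m) else b :: mergeInto a l f m

/-- Merge sort of the concatenation of the lists `F s, …, F (s + 2 ^ d - 1)`. -/
def mergeRange (F : ℕ → List (ℤ × ℕ)) : ℕ → ℕ → List (ℤ × ℕ)
  | 0, s => F s
  | d + 1, s => mergePairs (mergeRange F d s) (mergeRange F d (s + 2 ^ d))

/-- Whether the coefficients in each block of equal second components add up to zero,
when the list is preceded by `(c, k)`. -/
def cancels (c : ℤ) (k : ℕ) : List (ℤ × ℕ) → Bool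
  | [] => c == 0
  | (c', k') :: l => bif k.beq k' then forceInt (c + c') fun s => cancels s k l else (c == 0) && cancels c' k' l

/-- The indicator of the generators among the group elements given by `words`. -/
def generatorIndicator (i : ℕ) : ℤ := bif Nat.ble 72 i then 1 else 0

/-- The Gram matrix of the sum of squares minus that of the square of the Laplacian. -/
def differenceEntry (i j : ℕ) : ℤ :=
  gramEntry i j - 6000 * generatorIndicator i * generatorIndicator j

def differenceRowSum (i : ℕ) : ℤ := rangeSum (differenceEntry i) 84 0

/-- The terms charged to `i` in the expansion of `∑ d_ij (1 - g_i⁻¹) (1 - g_j) + 1000 Δ`: those in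
`g_i⁻¹`, in `g_i`, and in all `g_i⁻¹ g_j`. The merge tree has depth 7 because `84 ≤ 2 ^ 7`; the
surplus leaves are empty. -/
def differenceRow (i : ℕ) : List (ℤ × ℕ) :=
  bif Nat.blt i 84 then
    mergePairs
      (mergePairs [(-differenceRowSum i, (wordEntry i).adj.code.toNat)]
        [(-differenceRowSum i - 1000 * generatorIndicator i, (wordEntry i).code.toNat)])
      (mergeRange (fun j => bif Nat.blt j 84 then
        forceInt (differenceEntry i j) fun c =>
          forceNat ((wordEntry i).adj.mulCode (wordEntry j)).toNat fun k => [(c, k)] else []) 7 0)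
  else []

/-- The initial value `12000 = 1000 * 12` is the constant term of `1000 Δ`. -/
def differenceTotal : ℤ := rangeSum differenceRowSum 84 12000

/-- The terms of the difference of the two sides of the sum of squares decomposition, sorted. -/
def differenceTerms : List (ℤ × ℕ) :=
  mergePairs [(differenceTotal, (Entries.code ⟨1, 0, 0, 0, 1, 0, 0, 0, 1⟩).toNat)]
    (mergeRange differenceRow 7 0)

/-- Whether the residual of the Cholesky decomposition is diagonally dominant. -/
def residualDominant : Bool :=
  (List.range 84).all fun i =>
    -- The sum includes the diagonal term, whence the factor 2.
    decide (rangeSum (fun j => |gramResidual i j|) 84 0 ≤ 2 * gramResidual i i)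

/-- The main computation: its two halves give the positivity of the Gram matrix and the identity in
the group algebra. -/
theorem certificate_checks : (residualDominant && cancels 0 0 differenceTerms) = true := by
  decide +kernel
-- Meaning of the evaluation functions.
theorem forceNat_eq {α : Type} (n : ℕ) (f : ℕ → α) : forceNat n f = f n := by
  cases n <;> rfl

theorem forceInt_eq {α : Type} (z : ℤ) (f : ℤ → α) : forceInt z f = f z := by
  cases z with
  | ofNat n => exact forceNat_eq n fun m => f (Int.ofNat m)
  | negSucc n => exact forceNat_eq n fun m => f (Int.negSucc m)

theorem rangeSum_eq (f : ℕ → ℤ) (n : ℕ) (c : ℤ) :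
    rangeSum f n c = c + ∑ k ∈ Finset.range n, f k := by
  induction n generalizing c with
  | zero => simp [rangeSum]
  | succ n ih => rw [rangeSum, forceInt_eq, ih, Finset.sum_range_succ]; ring

/-- The default value 0 kills the terms beyond the end of either list, so rows of different lengths
may be treated as vectors of length 84. -/
theorem listDot_eq (l m : List ℤ) (c : ℤ) (n : ℕ) (hn : l.length ≤ n) :
    listDot l m c = c + ∑ k ∈ Finset.range n, l.getD k 0 * m.getD k 0 := by
  induction l generalizing m c n with
  | nil => simp [listDot]
  | cons a l ih =>
    cases m with
    | nil => simp [listDot]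
    | cons b m =>
      obtain ⟨n, rfl⟩ : ∃ k, n = k + 1 := ⟨n - 1, by simp at hn; omega⟩
      rw [listDot, forceInt_eq, ih m _ n (by simpa using hn), Finset.sum_range_succ']
      simp only [List.getD_cons_zero, List.getD_cons_succ]
      ring

theorem length_decodeRow (k n : ℕ) : (decodeRow k n).length = k := by
  induction k generalizing n with
  | zero => rfl
  | succ k ih => simp [decodeRow, forceInt_eq, forceNat_eq, ih]

theorem cholGram_eq (i j : ℕ) (hi : i < 84) (hj : j < 84) :
    cholGram i j = ∑ k ∈ Finset.range 84, (cholRow i).getD k 0 * (cholRow j).getD k 0 := by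
  have h (i : ℕ) (hi : i < 84) : (cholRow i).length ≤ 84 := by
    rw [cholRow, length_decodeRow]; omega
  unfold cholGram
  cases i.ble j
  · rw [cond_false, listDot_eq _ _ _ 84 (h j hj), zero_add]
    exact Finset.sum_congr rfl fun k _ => mul_comm _ _
  · rw [cond_true, listDot_eq _ _ _ 84 (h i hi), zero_add]

theorem gramEntry_comm (i j : ℕ) (hi : i < 84) (hj : j < 84) :
    gramEntry i j = gramEntry j i := by
  have h : cholGram i j = cholGram j i := by
    rw [cholGram_eq i j hi hj, cholGram_eq j i hj hi]
    exact Finset.sum_congr rfl fun k _ => mul_comm _ _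
  have h' : i.beq j = j.beq i := by
    rw [Bool.eq_iff_iff, Nat.beq_eq, Nat.beq_eq, eq_comm]
  rw [gramEntry, gramEntry, h, h']

/-! ### Formal sums represented by lists. -/

/-- The value of a list of pairs `(c, k)` as the sum of the elements `c • v k`. -/
def evalPairs {A : Type*} [AddCommGroup A] (v : ℕ → A) (l : List (ℤ × ℕ)) : A :=
  (l.map fun p => p.1 • v p.2).sum

section evalPairs

variable {A : Type*} [AddCommGroup A] (v : ℕ → A)

theorem evalPairs_nil : evalPairs v [] = 0 := rfl

theorem evalPairs_cons (p : ℤ × ℕ) (l : List (ℤ × ℕ)) :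
    evalPairs v (p :: l) = p.1 • v p.2 + evalPairs v l := by
  simp [evalPairs]

theorem evalPairs_mergeInto (a : ℤ × ℕ) (l : List (ℤ × ℕ))
    (f : List (ℤ × ℕ) → List (ℤ × ℕ))
    (hf : ∀ m, evalPairs v (f m) = evalPairs v l + evalPairs v m) (m : List (ℤ × ℕ)) :
    evalPairs v (mergePairs.mergeInto a l f m) =
      a.1 • v a.2 + evalPairs v l + evalPairs v m := by
  induction m with
  | nil => rw [mergePairs.mergeInto, evalPairs_cons, evalPairs_nil, add_zero]
  | cons b m ih =>
    rw [mergePairs.mergeInto]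
    cases a.2.ble b.2
    · rw [cond_false, evalPairs_cons, evalPairs_cons, ih]; abel
    · rw [cond_true, evalPairs_cons, hf]; abel

/-- Only preservation of the sum is needed. That the output is sorted is never proved: a badly
sorted list could only make `cancels` fail. -/
theorem evalPairs_mergePairs (l m : List (ℤ × ℕ)) :
    evalPairs v (mergePairs l m) = evalPairs v l + evalPairs v m := by
  induction l generalizing m with
  | nil => rw [mergePairs, evalPairs_nil, zero_add]
  | cons a l ih => rw [mergePairs, evalPairs_mergeInto v a l _ ih, evalPairs_cons]

theorem evalPairs_mergeRange (F : ℕ → List (ℤ × ℕ)) (d s : ℕ) :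
    evalPairs v (mergeRange F d s) = ∑ k ∈ Finset.range (2 ^ d), evalPairs v (F (s + k)) := by
  induction d generalizing s with
  | zero => simp [mergeRange]
  | succ d ih =>
    rw [mergeRange, evalPairs_mergePairs, ih, ih, pow_succ, mul_two, Finset.sum_range_add]
    simp only [add_assoc]

theorem evalPairs_mergeRange_of_le (F : ℕ → List (ℤ × ℕ)) (d n : ℕ) (hn : n ≤ 2 ^ d) :
    evalPairs v (mergeRange (fun k => bif Nat.blt k n then F k else []) d 0) =
      ∑ k ∈ Finset.range n, evalPairs v (F k) := by
  rw [evalPairs_mergeRange,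
    ← Finset.sum_subset (Finset.range_mono hn : Finset.range n ⊆ Finset.range (2 ^ d))]
  · refine Finset.sum_congr rfl fun k hk => ?_
    rw [zero_add, Nat.blt_eq.mpr (Finset.mem_range.1 hk), cond_true]
  · intro k _ hk
    have : Nat.blt k n = false := by
      rw [← Bool.not_eq_true, Nat.blt_eq]; simpa using hk
    rw [zero_add, this, cond_false, evalPairs_nil]

/-- The pair `(c, k)` is the run in progress with its accumulated coefficient; each run of equal
keys vanishes on its own, whatever `v` is. -/
theorem evalPairs_eq_zero_of_cancels (l : List (ℤ × ℕ)) (c : ℤ) (k : ℕ)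
    (h : cancels c k l = true) : c • v k + evalPairs v l = 0 := by
  induction l generalizing c k with
  | nil =>
    have : c = 0 := by simpa [cancels] using h
    simp [this, evalPairs_nil]
  | cons p l ih =>
    obtain ⟨c', k'⟩ := p
    rw [cancels] at h
    rw [evalPairs_cons]
    cases hk : k.beq k'
    · rw [hk, cond_false, Bool.and_eq_true, beq_iff_eq] at h
      rw [h.1, zero_smul, zero_add, ih _ _ h.2]
    · rw [hk, cond_true, forceInt_eq] at h
      rw [← Nat.eq_of_beq_eq_true hk, ← add_assoc, ← add_smul, ih _ _ h]

end evalPairs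

/-! ### Positivity of the Gram matrix. -/

theorem two_mul_abs_mul_le (a b : ℝ) : 2 * |a * b| ≤ a ^ 2 + b ^ 2 := by
  rw [abs_mul, ← sq_abs a, ← sq_abs b]
  nlinarith [sq_nonneg (|a| - |b|)]

/-- A symmetric diagonally dominant real matrix is positive semidefinite. -/
theorem posSemidef_of_diagonally_dominant {ι : Type*} [Fintype ι] (R : Matrix ι ι ℝ)
    (hR : ∀ i j, R i j = R j i) (h : ∀ i, ∑ j, |R i j| ≤ 2 * R i i) : R.PosSemidef := by
  classical
  -- Each off-diagonal term is at least `-|R i j| (x i ^ 2 + x j ^ 2) / 2`; by symmetry these bounds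
  -- add up to row sums times `x i ^ 2`, which the diagonal absorbs.
  have key (x : ι → ℝ) : 0 ≤ ∑ i, ∑ j, R i j * (x i * x j) := by
    have h1 (i : ι) : R i i * x i ^ 2 - ∑ j ∈ Finset.univ.erase i, |R i j| * |x i * x j| ≤
        ∑ j, R i j * (x i * x j) := by
      rw [← Finset.add_sum_erase _ _ (Finset.mem_univ i), ← sq, sub_eq_add_neg,
        ← Finset.sum_neg_distrib]
      refine add_le_add le_rfl (Finset.sum_le_sum fun j _ => ?_)
      rw [← abs_mul]
      exact neg_abs_le _
    have h2 (i : ι) : ∑ j ∈ Finset.univ.erase i, |R i j| * |x i * x j| ≤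
        ∑ j ∈ Finset.univ.erase i, (|R i j| * x i ^ 2 + |R i j| * x j ^ 2) / 2 := by
      refine Finset.sum_le_sum fun j _ => ?_
      nlinarith [two_mul_abs_mul_le (x i) (x j), abs_nonneg (R i j)]
    have hd (i : ι) : 0 ≤ R i i := by
      have := Finset.sum_nonneg fun j (_ : j ∈ Finset.univ) => abs_nonneg (R i j)
      linarith [h i]
    have h3 (i : ι) : ∑ j ∈ Finset.univ.erase i, |R i j| ≤ R i i := by
      have := h i
      rw [← Finset.add_sum_erase _ _ (Finset.mem_univ i), abs_of_nonneg (hd i)] at this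
      linarith
    have h4 : ∑ i, ∑ j ∈ Finset.univ.erase i, |R i j| * x j ^ 2 =
        ∑ i, ∑ j ∈ Finset.univ.erase i, |R i j| * x i ^ 2 := by
      simp only [← Finset.filter_ne', Finset.sum_filter]
      rw [Finset.sum_comm]
      refine Finset.sum_congr rfl fun i _ => Finset.sum_congr rfl fun j _ => ?_
      rw [hR i j]
      simp only [ne_comm]
    have h5 : ∑ i, ∑ j ∈ Finset.univ.erase i, (|R i j| * x i ^ 2 + |R i j| * x j ^ 2) / 2 =
        ∑ i, ∑ j ∈ Finset.univ.erase i, |R i j| * x i ^ 2 := by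
      simp only [← Finset.sum_div, Finset.sum_add_distrib]
      rw [h4]; ring
    have h6 : ∑ i, ∑ j ∈ Finset.univ.erase i, |R i j| * x i ^ 2 ≤ ∑ i, R i i * x i ^ 2 := by
      refine Finset.sum_le_sum fun i _ => ?_
      rw [← Finset.sum_mul]
      exact mul_le_mul_of_nonneg_right (h3 i) (sq_nonneg _)
    have h7 := Finset.sum_le_sum fun i (_ : i ∈ Finset.univ) => h1 i
    have h8 := Finset.sum_le_sum fun i (_ : i ∈ Finset.univ) => h2 i
    rw [Finset.sum_sub_distrib] at h7
    linarith
  refine Matrix.PosSemidef.of_dotProduct_mulVec_nonneg ?_ fun x => ?_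
  · ext i j; simp [hR i j]
  · have hx : star x ⬝ᵥ R.mulVec x = ∑ i, ∑ j, R i j * (x i * x j) := by
      simp only [dotProduct, Matrix.mulVec, Finset.mul_sum, Pi.star_apply, star_trivial]
      refine Finset.sum_congr rfl fun i _ => Finset.sum_congr rfl fun j _ => ?_
      ring
    rw [hx]
    exact key x

/-- The Gram matrix of the sum of squares as a real matrix. -/
def gramMatrix : Matrix (Fin 84) (Fin 84) ℝ := Matrix.of fun i j => (gramEntry i j : ℝ)

theorem gramMatrix_posSemidef : gramMatrix.PosSemidef := by
  let B : Matrix (Fin 84) (Fin 84) ℝ := Matrix.of fun i k => ((cholRow i).getD k 0 : ℝ)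
  let R : Matrix (Fin 84) (Fin 84) ℝ := Matrix.of fun i j => (gramResidual i j : ℝ)
  have hchol (i j : Fin 84) : (B * B.transpose) i j = (cholGram i j : ℝ) := by
    rw [cholGram_eq i j i.2 j.2, Matrix.mul_apply,
      Finset.sum_range fun k => (cholRow i).getD k 0 * (cholRow j).getD k 0]
    push_cast
    rfl
  have hcomm (i j : Fin 84) : R i j = R j i := by
    have h1 := gramEntry_comm i j i.2 j.2
    have h2 : cholGram i j = cholGram j i := by
      rw [cholGram_eq i j i.2 j.2, cholGram_eq j i j.2 i.2]
      exact Finset.sum_congr rfl fun k _ => mul_comm _ _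
    simp only [R, Matrix.of_apply, gramResidual, h1, h2]
  have hR : R.PosSemidef := by
    refine posSemidef_of_diagonally_dominant R hcomm fun i => ?_
    have h := (Bool.and_eq_true_iff.1 certificate_checks).1
    rw [residualDominant, List.all_eq_true] at h
    have h := of_decide_eq_true (h i (List.mem_range.2 i.2))
    rw [rangeSum_eq, zero_add, Finset.sum_range fun j => |gramResidual i j|] at h
    simp only [R, Matrix.of_apply]
    exact_mod_cast h
  have hB : (B * B.transpose).PosSemidef := by
    simpa using Matrix.posSemidef_self_mul_conjTranspose B
  -- The definition of the residual rearranged: `R` carries all the inaccuracy of the factor.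
  have h : gramMatrix = (1 / 4000000 : ℝ) • (R + B * B.transpose) := by
    ext i j
    rw [Matrix.smul_apply, Matrix.add_apply, hchol, smul_eq_mul]
    simp only [R, gramMatrix, Matrix.of_apply, gramResidual]
    push_cast
    ring
  rw [h]
  exact (hR.add hB).smul (by norm_num)

/-! ### Entries and codes of integer matrices. -/

namespace Entries

/-- The entries of a matrix. -/
def ofMatrix (M : Matrix (Fin 3) (Fin 3) ℤ) : Entries :=
  ⟨M 0 0, M 0 1, M 0 2, M 1 0, M 1 1, M 1 2, M 2 0, M 2 1, M 2 2⟩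

theorem ofMatrix_injective : Function.Injective ofMatrix := by
  intro M N h
  simp only [ofMatrix, Entries.mk.injEq] at h
  ext i j
  fin_cases i <;> fin_cases j <;> simp [h]

theorem ofMatrix_mul (M N : Matrix (Fin 3) (Fin 3) ℤ) :
    ofMatrix (M * N) = (ofMatrix M).mul (ofMatrix N) := by
  simp [ofMatrix, mul, Matrix.mul_apply, Fin.sum_univ_three]

theorem ofMatrix_inv (g : SL(3, ℤ)) :
    ofMatrix (g⁻¹).1 = (ofMatrix g.1).adj := by
  rw [Matrix.SpecialLinearGroup.coe_inv, Matrix.adjugate_fin_three]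
  simp only [ofMatrix, adj, Matrix.of_apply, Matrix.cons_val', Matrix.cons_val_zero,
    Matrix.cons_val_one, Matrix.cons_val, Entries.mk.injEq]
  refine ⟨?_, ?_, ?_, ?_, ?_, ?_, ?_, ?_, ?_⟩ <;> first | trivial | ring

theorem mulCode_eq (x y : Entries) : x.mulCode y = (x.mul y).code := by
  simp only [mulCode, mul, code, rowCode]
  ring

/-- All entries have absolute value at most `n`. -/
def Bounded (n : ℤ) (x : Entries) : Prop :=
  (|x.a| ≤ n ∧ |x.b| ≤ n ∧ |x.c| ≤ n) ∧ (|x.d| ≤ n ∧ |x.e| ≤ n ∧ |x.f| ≤ n) ∧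
    (|x.g| ≤ n ∧ |x.h| ≤ n ∧ |x.i| ≤ n)

instance (n : ℤ) (x : Entries) : Decidable (Bounded n x) := by
  unfold Bounded; infer_instance

theorem Bounded.mono {m n : ℤ} {x : Entries} (hx : Bounded m x) (h : m ≤ n) : Bounded n x := by
  obtain ⟨⟨h1, h2, h3⟩, ⟨h4, h5, h6⟩, h7, h8, h9⟩ := hx
  exact ⟨⟨h1.trans h, h2.trans h, h3.trans h⟩, ⟨h4.trans h, h5.trans h, h6.trans h⟩,
    h7.trans h, h8.trans h, h9.trans h⟩

theorem abs_mul_add_mul_add_mul_le {a b c x y z : ℤ} (ha : |a| ≤ 1) (hb : |b| ≤ 1)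
    (hc : |c| ≤ 1) (hx : |x| ≤ 1) (hy : |y| ≤ 1) (hz : |z| ≤ 1) :
    |a * x + b * y + c * z| ≤ 3 := by
  have h {a x : ℤ} (ha : |a| ≤ 1) (hx : |x| ≤ 1) : |a * x| ≤ 1 := by
    rw [abs_mul]; exact mul_le_one₀ ha (abs_nonneg _) hx
  exact (abs_add_three _ _ _).trans (by linarith [h ha hx, h hb hy, h hc hz])

theorem Bounded.mul {x y : Entries} (hx : Bounded 1 x) (hy : Bounded 1 y) :
    Bounded 3 (x.mul y) := by
  obtain ⟨⟨h1, h2, h3⟩, ⟨h4, h5, h6⟩, h7, h8, h9⟩ := hx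
  obtain ⟨⟨k1, k2, k3⟩, ⟨k4, k5, k6⟩, k7, k8, k9⟩ := hy
  refine ⟨⟨?_, ?_, ?_⟩, ⟨?_, ?_, ?_⟩, ?_, ?_, ?_⟩ <;>
    exact abs_mul_add_mul_add_mul_le ‹_› ‹_› ‹_› ‹_› ‹_› ‹_›

theorem code_nonneg {x : Entries} (hx : Bounded 3 x) : 0 ≤ x.code := by
  obtain ⟨⟨h1, h2, h3⟩, ⟨h4, h5, h6⟩, h7, h8, h9⟩ := hx
  rw [abs_le] at h1 h2 h3 h4 h5 h6 h7 h8 h9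
  unfold code
  linarith

/-- Two digits between -3 and 3 that agree modulo 7 are equal. -/
theorem digit_eq {r s u v : ℤ} (hu : |u| ≤ 3) (hv : |v| ≤ 3) (h : r * 7 + u = s * 7 + v) :
    r = s ∧ u = v := by
  rw [abs_le] at hu hv
  omega

/-- The digits are peeled off from the last entry upwards. The leading entry is what remains, so its
bound serves only to make the codes nonnegative. -/
theorem eq_of_code_toNat_eq {x y : Entries} (hx : Bounded 3 x) (hy : Bounded 3 y)
    (h : x.code.toNat = y.code.toNat) : x = y := by
  have h : x.code = y.code := by
    have h1 := code_nonneg hx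
    have h2 := code_nonneg hy
    omega
  obtain ⟨a, b, c, d, e, f, g, p, q⟩ := x
  obtain ⟨a', b', c', d', e', f', g', p', q'⟩ := y
  obtain ⟨⟨_, h2, h3⟩, ⟨h4, h5, h6⟩, h7, h8, h9⟩ := hx
  obtain ⟨⟨_, k2, k3⟩, ⟨k4, k5, k6⟩, k7, k8, k9⟩ := hy
  dsimp only at *
  have h : (((((((a * 7 + b) * 7 + c) * 7 + d) * 7 + e) * 7 + f) * 7 + g) * 7 + p) * 7 + q =
      (((((((a' * 7 + b') * 7 + c') * 7 + d') * 7 + e') * 7 + f') * 7 + g') * 7 + p') * 7 + q' := by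
    simp only [code] at h
    linarith
  obtain ⟨e0, rfl⟩ := digit_eq h9 k9 h
  obtain ⟨e1, rfl⟩ := digit_eq h8 k8 e0
  obtain ⟨e2, rfl⟩ := digit_eq h7 k7 e1
  obtain ⟨e3, rfl⟩ := digit_eq h6 k6 e2
  obtain ⟨e4, rfl⟩ := digit_eq h5 k5 e3
  obtain ⟨e5, rfl⟩ := digit_eq h4 k4 e4
  obtain ⟨e6, rfl⟩ := digit_eq h3 k3 e5
  obtain ⟨rfl, rfl⟩ := digit_eq h2 k2 e6
  rfl

end Entries

/-! ### The words as elements of the group. -/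

/-- The elements of `elementaryGenerators`, followed by `1`. -/
def generatorList : List SL(3, ℤ) :=
  [elementaryUpper 0, elementaryUpper 1, elementaryUpper 2,
    (elementaryUpper 0).transpose, (elementaryUpper 1).transpose, (elementaryUpper 2).transpose,
    (elementaryUpper 0)⁻¹, (elementaryUpper 1)⁻¹, (elementaryUpper 2)⁻¹,
    (elementaryUpper 0).transpose⁻¹, (elementaryUpper 1).transpose⁻¹,
    (elementaryUpper 2).transpose⁻¹, 1]

theorem map_generatorList :
    generatorList.map (fun g => Entries.ofMatrix g.1) = generatorEntries := by
  decide +kernel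

def generator (a : ℕ) : SL(3, ℤ) := generatorList.getD a 1

theorem ofMatrix_generator (a : ℕ) :
    Entries.ofMatrix (generator a).1 = generatorEntry a := by
  rw [generatorEntry, ← map_generatorList, generator,
    show (⟨1, 0, 0, 0, 1, 0, 0, 0, 1⟩ : Entries) =
      (fun g : SL(3, ℤ) => Entries.ofMatrix g.1) 1 by decide +kernel, List.getD_map]

theorem generator_mem (a : ℕ) : generator a ∈ elementaryGenerators ∨ generator a = 1 := by
  have h : ∀ g ∈ generatorList, g ∈ elementaryGenerators ∨ g = 1 := by decide +kernel
  rcases lt_or_ge a generatorList.length with ha | ha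
  · rw [generator, List.getD_eq_getElem _ _ ha]
    exact h _ (List.getElem_mem ha)
  · exact Or.inr (List.getD_eq_default _ _ ha)

/-- The group elements in the sum of squares. -/
def wordElement (i : ℕ) : SL(3, ℤ) :=
  generator (words.getD i (12, 12)).1 * generator (words.getD i (12, 12)).2

theorem one_mem_wordBall {Γ : Type*} [Group Γ] (S : Finset Γ) (k : ℕ) : 1 ∈ wordBall S k :=
  ⟨[], by simp, by simp, rfl⟩

theorem wordElement_mem_wordBall (i : ℕ) : wordElement i ∈ wordBall elementaryGenerators 2 := by
  unfold wordElement
  generalize (words.getD i (12, 12)).1 = a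
  generalize (words.getD i (12, 12)).2 = b
  rcases generator_mem a with ha | ha <;> rcases generator_mem b with hb | hb
  · exact ⟨[generator a, generator b], by simp, by simp [ha, hb], by simp⟩
  · exact ⟨[generator a], by simp, by simp [ha], by simp [hb]⟩
  · exact ⟨[generator b], by simp, by simp [hb], by simp [ha]⟩
  · rw [ha, hb, one_mul]
    exact one_mem_wordBall _ _

theorem ofMatrix_wordElement (i : ℕ) : Entries.ofMatrix (wordElement i).1 = wordEntry i := by
  rw [wordElement, Matrix.SpecialLinearGroup.coe_mul, Entries.ofMatrix_mul, ofMatrix_generator,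
    ofMatrix_generator, wordEntry]

theorem bounded_wordEntry {i : ℕ} (hi : i ∈ Finset.range 84) :
    (wordEntry i).Bounded 1 ∧ (wordEntry i).adj.Bounded 1 := by
  have h : ∀ i < 84, (wordEntry i).Bounded 1 ∧ (wordEntry i).adj.Bounded 1 := by decide +kernel
  exact h i (Finset.mem_range.1 hi)

theorem image_wordElement : (Finset.Ico 72 84).image wordElement = elementaryGenerators := by
  decide +kernel

theorem image_wordElement_inv :
    (Finset.Ico 72 84).image (fun i => (wordElement i)⁻¹) = elementaryGenerators := by
  decide +kernel

/-- The indexing is injective by counting: 12 indices have an image with 12 elements. -/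
theorem sum_elementaryGenerators {A : Type*} [AddCommMonoid A] (f : SL(3, ℤ) → A) :
    ∑ s ∈ elementaryGenerators, f s = ∑ i ∈ Finset.Ico 72 84, f (wordElement i) := by
  rw [← image_wordElement, Finset.sum_image]
  refine Finset.injOn_of_card_image_eq ?_
  rw [image_wordElement, card_elementaryGenerators, Nat.card_Ico]

theorem sum_elementaryGenerators_inv {A : Type*} [AddCommMonoid A] (f : SL(3, ℤ) → A) :
    ∑ s ∈ elementaryGenerators, f s = ∑ i ∈ Finset.Ico 72 84, f (wordElement i)⁻¹ := by
  rw [← image_wordElement_inv, Finset.sum_image]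
  refine Finset.injOn_of_card_image_eq ?_
  rw [image_wordElement_inv, card_elementaryGenerators, Nat.card_Ico]

theorem sum_generatorIndicator {A : Type*} [AddCommGroup A] (f : ℕ → A) :
    ∑ i ∈ Finset.range 84, generatorIndicator i • f i = ∑ i ∈ Finset.Ico 72 84, f i := by
  rw [Finset.range_eq_Ico, ← Finset.sum_Ico_consecutive _ (Nat.zero_le 72) (by norm_num : 72 ≤ 84),
    Finset.sum_eq_zero, zero_add]
  · refine Finset.sum_congr rfl fun i hi => ?_
    rw [generatorIndicator, Nat.ble_eq.mpr (Finset.mem_Ico.1 hi).1, cond_true, one_smul]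
  · intro i hi
    have : Nat.ble 72 i = false := by
      rw [← Bool.not_eq_true, Nat.ble_eq]
      have := (Finset.mem_Ico.1 hi).2
      omega
    rw [generatorIndicator, this, cond_false, zero_smul]

/-- The group algebra element of the matrix with the given code. -/
def elementOfCode (k : ℕ) : MonoidAlgebra ℝ SL(3, ℤ) :=
  open Classical in
  if h : ∃ g : SL(3, ℤ), (Entries.ofMatrix g.1).Bounded 3 ∧
    (Entries.ofMatrix g.1).code.toNat = k then MonoidAlgebra.single h.choose 1 else 0

/-- The code determines a matrix with entries bounded by 3, so the matrix picked by choice is `g`.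
-/
theorem elementOfCode_eq (g : SL(3, ℤ)) (hg : (Entries.ofMatrix g.1).Bounded 3) :
    elementOfCode (Entries.ofMatrix g.1).code.toNat = MonoidAlgebra.single g 1 := by
  have h : ∃ g' : SL(3, ℤ), (Entries.ofMatrix g'.1).Bounded 3 ∧
    (Entries.ofMatrix g'.1).code.toNat = (Entries.ofMatrix g.1).code.toNat := ⟨g, hg, rfl⟩
  rw [elementOfCode, dif_pos h]
  congr 1
  exact Subtype.ext (Entries.ofMatrix_injective
    (Entries.eq_of_code_toNat_eq h.choose_spec.1 hg h.choose_spec.2))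

/-! ### The certificate as an identity in the group algebra. -/

/-- The element `1 - x` of the group algebra, where `x` is the `i`-th group element. -/
def wordDifference (i : ℕ) : MonoidAlgebra ℝ SL(3, ℤ) :=
  1 - MonoidAlgebra.single (wordElement i) 1

/-- The adjoint of `wordDifference i`. -/
def wordDifferenceStar (i : ℕ) : MonoidAlgebra ℝ SL(3, ℤ) :=
  1 - MonoidAlgebra.single (wordElement i)⁻¹ 1

theorem laplaceElement_eq_sum {A : Type*} (f : A → SL(3, ℤ)) (T : Finset A)
    (hT : T.card = 12)
    (hf : ∑ s ∈ elementaryGenerators, MonoidAlgebra.single s (1 : ℝ) =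
      ∑ i ∈ T, MonoidAlgebra.single (f i) 1) :
    laplaceElement elementaryGenerators = ∑ i ∈ T, (1 - MonoidAlgebra.single (f i) 1) := by
  rw [laplaceElement, hf, card_elementaryGenerators, Finset.sum_sub_distrib, Finset.sum_const, hT]
  simp [MonoidAlgebra.ofNat_def]

theorem laplaceElement_eq :
    laplaceElement elementaryGenerators =
      ∑ i ∈ Finset.range 84, generatorIndicator i • wordDifference i := by
  rw [sum_generatorIndicator]
  exact laplaceElement_eq_sum _ _ (Nat.card_Ico _ _) (sum_elementaryGenerators _)

/-- The generating set is closed under inverses. This form supplies the left factor when `Δ²` is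
written through products `(1 - g_i)^* (1 - g_j)`. -/
theorem laplaceElement_eq_star :
    laplaceElement elementaryGenerators =
      ∑ i ∈ Finset.range 84, generatorIndicator i • wordDifferenceStar i := by
  rw [sum_generatorIndicator]
  exact laplaceElement_eq_sum (fun i => (wordElement i)⁻¹) _ (Nat.card_Ico _ _)
    (sum_elementaryGenerators_inv _)

theorem differenceRowSum_eq (i : ℕ) :
    differenceRowSum i = ∑ j ∈ Finset.range 84, differenceEntry i j := by
  rw [differenceRowSum, rangeSum_eq, zero_add]

theorem evalPairs_differenceRow {i : ℕ} (hi : i ∈ Finset.range 84) :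
    evalPairs elementOfCode (differenceRow i) =
      -differenceRowSum i • MonoidAlgebra.single (wordElement i)⁻¹ (1 : ℝ) +
      (-differenceRowSum i - 1000 * generatorIndicator i) •
        MonoidAlgebra.single (wordElement i) (1 : ℝ) +
      ∑ j ∈ Finset.range 84, differenceEntry i j •
        (MonoidAlgebra.single (wordElement i)⁻¹ (1 : ℝ) *
          MonoidAlgebra.single (wordElement j) 1) := by
  have h1 : elementOfCode (wordEntry i).code.toNat = MonoidAlgebra.single (wordElement i) 1 := by
    rw [← ofMatrix_wordElement, elementOfCode_eq]
    rw [ofMatrix_wordElement]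
    exact (bounded_wordEntry hi).1.mono (by norm_num)
  have h2 : elementOfCode (wordEntry i).adj.code.toNat =
      MonoidAlgebra.single (wordElement i)⁻¹ 1 := by
    rw [← ofMatrix_wordElement, ← Entries.ofMatrix_inv, elementOfCode_eq]
    rw [Entries.ofMatrix_inv, ofMatrix_wordElement]
    exact (bounded_wordEntry hi).2.mono (by norm_num)
  have h3 {j : ℕ} (hj : j ∈ Finset.range 84) :
      elementOfCode ((wordEntry i).adj.mulCode (wordEntry j)).toNat =
        MonoidAlgebra.single (wordElement i)⁻¹ 1 * MonoidAlgebra.single (wordElement j) 1 := by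
    rw [MonoidAlgebra.single_mul_single, one_mul, Entries.mulCode_eq, ← ofMatrix_wordElement,
      ← ofMatrix_wordElement, ← Entries.ofMatrix_inv, ← Entries.ofMatrix_mul,
      ← Matrix.SpecialLinearGroup.coe_mul, elementOfCode_eq]
    rw [Matrix.SpecialLinearGroup.coe_mul, Entries.ofMatrix_mul, Entries.ofMatrix_inv,
      ofMatrix_wordElement, ofMatrix_wordElement]
    exact (bounded_wordEntry hi).2.mul (bounded_wordEntry hj).1
  rw [differenceRow, Nat.blt_eq.mpr (Finset.mem_range.1 hi), cond_true, evalPairs_mergePairs,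
    evalPairs_mergePairs, evalPairs_mergeRange_of_le _ _ _ _ (by norm_num)]
  simp only [evalPairs_cons, evalPairs_nil, add_zero, h1, h2, forceInt_eq, forceNat_eq]
  rw [Finset.sum_congr rfl fun j hj => congrArg (differenceEntry i j • ·) (h3 hj)]

theorem differenceTerms_eq_zero :
    differenceTotal • (1 : MonoidAlgebra ℝ SL(3, ℤ)) + ∑ i ∈ Finset.range 84,
      (-differenceRowSum i • MonoidAlgebra.single (wordElement i)⁻¹ (1 : ℝ) +
      (-differenceRowSum i - 1000 * generatorIndicator i) •
        MonoidAlgebra.single (wordElement i) (1 : ℝ) +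
      ∑ j ∈ Finset.range 84, differenceEntry i j •
        (MonoidAlgebra.single (wordElement i)⁻¹ (1 : ℝ) *
          MonoidAlgebra.single (wordElement j) 1)) = 0 := by
  have h := evalPairs_eq_zero_of_cancels elementOfCode _ _ _
    (Bool.and_eq_true_iff.1 certificate_checks).2
  have h1 : elementOfCode (Entries.code ⟨1, 0, 0, 0, 1, 0, 0, 0, 1⟩).toNat = 1 := by
    rw [show (⟨1, 0, 0, 0, 1, 0, 0, 0, 1⟩ : Entries) =
      Entries.ofMatrix (1 : SL(3, ℤ)).1 by decide +kernel, elementOfCode_eq _ (by decide +kernel),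
      MonoidAlgebra.one_def]
  have h2 : evalPairs elementOfCode (mergeRange differenceRow 7 0) =
      ∑ i ∈ Finset.range 84, evalPairs elementOfCode (differenceRow i) := by
    -- Rows from 84 on are already empty, so the padding required by the merge lemma changes
    -- nothing.
    have h3 : differenceRow = fun i => bif Nat.blt i 84 then differenceRow i else [] := by
      funext i
      cases hi : Nat.blt i 84
      · rw [cond_false, differenceRow, hi, cond_false]
      · rw [cond_true]
    rw [h3, evalPairs_mergeRange_of_le _ _ _ _ (by norm_num), ← h3]
  rw [zero_smul, zero_add, differenceTerms, evalPairs_mergePairs, evalPairs_cons, evalPairs_nil,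
    add_zero, h1, h2, Finset.sum_congr rfl fun i hi => evalPairs_differenceRow hi] at h
  dsimp only at h
  exact h

theorem differenceEntry_comm {i j : ℕ} (hi : i ∈ Finset.range 84) (hj : j ∈ Finset.range 84) :
    differenceEntry i j = differenceEntry j i := by
  rw [differenceEntry, differenceEntry,
    gramEntry_comm i j (Finset.mem_range.1 hi) (Finset.mem_range.1 hj)]
  ring

/-- By symmetry the column sums of `d` are its row sums, so the coefficients of `x i` and `y i`
agree; this is the shape that `differenceRow` encodes. -/
theorem sum_smul_one_sub_mul_one_sub {A : Type*} [Ring A] (T : Finset ℕ) (d : ℕ → ℕ → ℤ)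
    (x y : ℕ → A) (hd : ∀ i ∈ T, ∀ j ∈ T, d i j = d j i) :
    ∑ i ∈ T, ∑ j ∈ T, d i j • ((1 - x i) * (1 - y j)) =
      (∑ i ∈ T, ∑ j ∈ T, d i j) • (1 : A) + ∑ i ∈ T, (-(∑ j ∈ T, d i j) • x i +
        -(∑ j ∈ T, d i j) • y i + ∑ j ∈ T, d i j • (x i * y j)) := by
  have h : ∑ i ∈ T, ∑ j ∈ T, d i j • y j = ∑ i ∈ T, (∑ j ∈ T, d i j) • y i := by
    rw [Finset.sum_comm]
    refine Finset.sum_congr rfl fun i hi => ?_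
    rw [Finset.sum_smul]
    exact Finset.sum_congr rfl fun j hj => by rw [hd i hi j hj]
  have h' (i j : ℕ) : d i j • ((1 - x i) * (1 - y j)) =
      d i j • (1 : A) - d i j • x i - d i j • y j + d i j • (x i * y j) := by
    rw [← smul_sub, ← smul_sub, ← smul_add]
    congr 1
    noncomm_ring
  simp only [h', Finset.sum_add_distrib, Finset.sum_sub_distrib, h, neg_smul,
    Finset.sum_neg_distrib, Finset.sum_smul]
  abel

/-- Both expressions of `Δ` make `6000 Δ²` the form with matrix `6000 ε_i ε_j`, where `ε` indicates
the generators. The remaining form, with matrix `differenceEntry`, equals `-1000 Δ` by the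
cancellation check. -/
theorem sum_gramEntry :
    ∑ i ∈ Finset.range 84, ∑ j ∈ Finset.range 84,
      gramEntry i j • (wordDifferenceStar i * wordDifference j) =
      (6000 : ℤ) • laplaceElement elementaryGenerators ^ 2 -
        (1000 : ℤ) • laplaceElement elementaryGenerators := by
  have h1 : laplaceElement elementaryGenerators ^ 2 =
      ∑ i ∈ Finset.range 84, ∑ j ∈ Finset.range 84, (generatorIndicator i * generatorIndicator j) •
        (wordDifferenceStar i * wordDifference j) := by
    rw [sq]
    nth_rw 1 [laplaceElement_eq_star]
    rw [laplaceElement_eq, Finset.sum_mul_sum]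
    simp only [smul_mul_smul_comm]
  have h2 : ∑ i ∈ Finset.range 84, ∑ j ∈ Finset.range 84,
      differenceEntry i j • (wordDifferenceStar i * wordDifference j) =
        -((1000 : ℤ) • laplaceElement elementaryGenerators) := by
    have h3 : ∑ i ∈ Finset.range 84, (1000 * generatorIndicator i) •
        MonoidAlgebra.single (wordElement i) (1 : ℝ) =
        (12000 : ℤ) • 1 - (1000 : ℤ) • laplaceElement elementaryGenerators := by
      simp only [mul_smul, ← Finset.smul_sum]
      rw [sum_generatorIndicator, ← sum_elementaryGenerators fun s => MonoidAlgebra.single s (1 : ℝ),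
        laplaceElement, card_elementaryGenerators]
      simp only [smul_sub, Nat.cast_ofNat, map_ofNat]
      rw [show (1000 : ℤ) • (12 : MonoidAlgebra ℝ SL(3, ℤ)) = (12000 : ℤ) • 1 by
        simp only [zsmul_eq_mul]; norm_num]
      abel
    have h4 := differenceTerms_eq_zero
    simp only [sub_smul, Finset.sum_add_distrib, Finset.sum_sub_distrib, h3] at h4
    simp only [wordDifferenceStar, wordDifference]
    rw [sum_smul_one_sub_mul_one_sub _ _ _ _ fun i hi j hj => differenceEntry_comm hi hj]
    simp only [← differenceRowSum_eq, Finset.sum_add_distrib]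
    rw [differenceTotal, rangeSum_eq, add_smul] at h4
    rw [← sub_eq_zero, ← h4]
    abel
  rw [h1, sub_eq_add_neg, ← h2]
  simp only [Finset.smul_sum, ← Finset.sum_add_distrib, smul_smul, ← add_smul]
  refine Finset.sum_congr rfl fun i _ => Finset.sum_congr rfl fun j _ => ?_
  congr 1
  rw [differenceEntry]
  ring

/-! ### From the Gram matrix to a sum of squares. -/

section groupAlgebraStar

variable {Γ : Type*} [Group Γ]

/-- The involution of the group algebra as a linear map. -/
def groupAlgebraStarLinear : MonoidAlgebra ℝ Γ →ₗ[ℝ] MonoidAlgebra ℝ Γ where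
  toFun := groupAlgebraStar
  map_add' x y := by
    simp only [groupAlgebraStar, MonoidAlgebra.coeff_add]
    exact Finsupp.sum_add_index' (fun _ => MonoidAlgebra.single_zero _)
      fun _ _ _ => MonoidAlgebra.single_add _ _ _
  map_smul' c x := by
    simp only [groupAlgebraStar, MonoidAlgebra.coeff_smul, RingHom.id_apply]
    rw [Finsupp.sum_smul_index fun _ => MonoidAlgebra.single_zero _, Finsupp.smul_sum]
    simp only [MonoidAlgebra.smul_single, smul_eq_mul]

theorem groupAlgebraStarLinear_apply (x : MonoidAlgebra ℝ Γ) :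
    groupAlgebraStarLinear x = groupAlgebraStar x := rfl

theorem groupAlgebraStar_single (g : Γ) (c : ℝ) :
    groupAlgebraStar (MonoidAlgebra.single g c) = MonoidAlgebra.single g⁻¹ c := by
  rw [groupAlgebraStar, MonoidAlgebra.coeff_single]
  exact Finsupp.sum_single_index (MonoidAlgebra.single_zero _)

end groupAlgebraStar

theorem groupAlgebraStar_wordDifference (i : ℕ) :
    groupAlgebraStar (wordDifference i) = wordDifferenceStar i := by
  rw [wordDifference, wordDifferenceStar, MonoidAlgebra.one_def, ← groupAlgebraStarLinear_apply,
    map_sub]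
  simp only [groupAlgebraStarLinear_apply, groupAlgebraStar_single, inv_one]

theorem groupAlgebraStar_sum_smul_wordDifference {n : ℕ} (c : Fin n → ℝ) :
    groupAlgebraStar (∑ k, c k • wordDifference k) = ∑ k, c k • wordDifferenceStar k := by
  rw [← groupAlgebraStarLinear_apply, map_sum]
  simp only [map_smul, groupAlgebraStarLinear_apply, groupAlgebraStar_wordDifference]

theorem support_sum_smul_wordDifference_subset {n : ℕ} (c : Fin n → ℝ) :
    (∑ k, c k • wordDifference k).coeff.support ⊆
      insert 1 ((Finset.range n).image wordElement) := by
  intro g hg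
  by_contra h
  rw [Finset.mem_insert, not_or, Finset.mem_image, not_exists] at h
  refine Finsupp.mem_support_iff.1 hg ?_
  rw [MonoidAlgebra.coeff_sum, Finsupp.finsetSum_apply]
  refine Finset.sum_eq_zero fun k _ => ?_
  have hk : wordElement k ≠ g := fun e => h.2 k ⟨Finset.mem_range.2 k.2, e⟩
  rw [MonoidAlgebra.coeff_smul, wordDifference, MonoidAlgebra.coeff_sub, MonoidAlgebra.one_def,
    MonoidAlgebra.coeff_single, MonoidAlgebra.coeff_single, Finsupp.smul_apply, Finsupp.sub_apply,
    Finsupp.single_eq_of_ne h.1, Finsupp.single_eq_of_ne hk.symm, sub_zero, smul_zero]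

open scoped MatrixOrder in
theorem exists_transpose_mul_self_of_posSemidef {ι : Type*} [Fintype ι] [DecidableEq ι]
    {Q : Matrix ι ι ℝ} (hQ : Q.PosSemidef) : ∃ B : Matrix ι ι ℝ, Q = B.transpose * B := by
  obtain ⟨B, hB⟩ := CStarAlgebra.nonneg_iff_eq_star_mul_self.mp hQ.nonneg
  exact ⟨B, by rw [hB, Matrix.star_eq_conjTranspose, Matrix.conjTranspose_eq_transpose_of_trivial]⟩

/-- With `G / 6000 = Bᵀ B`, the rows of `B` are the coefficients of the squared elements in terms of
the `1 - g_k`. -/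
theorem exists_sum_squares :
    ∃ b : Fin 84 → MonoidAlgebra ℝ SL(3, ℤ),
      (∀ i, (b i).coeff.support ⊆ insert 1 ((Finset.range 84).image wordElement)) ∧
      laplaceElement elementaryGenerators ^ 2 -
          (1 / 6 : ℝ) • laplaceElement elementaryGenerators =
        ∑ i, groupAlgebraStar (b i) * b i := by
  obtain ⟨B, hB⟩ := exists_transpose_mul_self_of_posSemidef
    (gramMatrix_posSemidef.smul (by norm_num : (0 : ℝ) ≤ 1 / 6000))
  refine ⟨fun i => ∑ k, B i k • wordDifference k,
    fun i => support_sum_smul_wordDifference_subset _, ?_⟩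
  have h1 : laplaceElement elementaryGenerators ^ 2 -
      (1 / 6 : ℝ) • laplaceElement elementaryGenerators =
        (1 / 6000 : ℝ) • ∑ k : Fin 84, ∑ l : Fin 84,
          (gramEntry k l : ℝ) • (wordDifferenceStar k * wordDifference l) := by
    have h2 := sum_gramEntry
    simp only [Finset.sum_range] at h2
    simp only [Int.cast_smul_eq_zsmul]
    rw [h2, smul_sub, ← Int.cast_smul_eq_zsmul ℝ, ← Int.cast_smul_eq_zsmul ℝ, smul_smul, smul_smul]
    norm_num
  simp only [groupAlgebraStar_sum_smul_wordDifference, Finset.sum_mul_sum, smul_mul_smul_comm]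
  rw [h1, Finset.smul_sum, Finset.sum_comm]
  refine Finset.sum_congr rfl fun k _ => ?_
  rw [Finset.smul_sum, Finset.sum_comm]
  refine Finset.sum_congr rfl fun l _ => ?_
  have h3 := congrFun (congrFun hB k) l
  rw [Matrix.smul_apply, Matrix.mul_apply, smul_eq_mul] at h3
  rw [smul_smul, ← Finset.sum_smul]
  exact congrArg (· • _) h3

/-! ### Generation of `SL(3, ℤ)` by elementary matrices. -/

namespace Matrix.SpecialLinearGroup

/-- A `2 × 2` matrix as the upper left block of a `3 × 3` matrix. -/
def upperLeftMatrix (M : Matrix (Fin 2) (Fin 2) ℤ) : Matrix (Fin 3) (Fin 3) ℤ :=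
  !![M 0 0, M 0 1, 0; M 1 0, M 1 1, 0; 0, 0, 1]

theorem upperLeftMatrix_mul (M N : Matrix (Fin 2) (Fin 2) ℤ) :
    upperLeftMatrix (M * N) = upperLeftMatrix M * upperLeftMatrix N := by
  ext i j
  fin_cases i <;> fin_cases j <;>
    simp [upperLeftMatrix, Matrix.mul_apply, Fin.sum_univ_three]

/-- The embedding of `SL(2, ℤ)` into `SL(3, ℤ)` as the upper left block. -/
def upperLeft : SL(2, ℤ) →* SL(3, ℤ) where
  toFun γ := ⟨upperLeftMatrix γ.1, by
    have := γ.2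
    rw [Matrix.det_fin_two] at this
    simp [upperLeftMatrix, Matrix.det_fin_three, this]⟩
  map_one' := by ext i j; fin_cases i <;> fin_cases j <;> simp [upperLeftMatrix]
  map_mul' γ δ := Subtype.ext (upperLeftMatrix_mul γ.1 δ.1)

theorem upperLeft_val (γ : SL(2, ℤ)) : (upperLeft γ).1 = upperLeftMatrix γ.1 := rfl

/-- A `2 × 2` matrix as the lower right block of a `3 × 3` matrix. -/
def lowerRightMatrix (M : Matrix (Fin 2) (Fin 2) ℤ) : Matrix (Fin 3) (Fin 3) ℤ :=
  !![1, 0, 0; 0, M 0 0, M 0 1; 0, M 1 0, M 1 1]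

theorem lowerRightMatrix_mul (M N : Matrix (Fin 2) (Fin 2) ℤ) :
    lowerRightMatrix (M * N) = lowerRightMatrix M * lowerRightMatrix N := by
  ext i j
  fin_cases i <;> fin_cases j <;>
    simp [lowerRightMatrix, Matrix.mul_apply, Fin.sum_univ_three]

/-- The embedding of `SL(2, ℤ)` into `SL(3, ℤ)` as the lower right block. -/
def lowerRight : SL(2, ℤ) →* SL(3, ℤ) where
  toFun γ := ⟨lowerRightMatrix γ.1, by
    have := γ.2
    rw [Matrix.det_fin_two] at this
    simp [lowerRightMatrix, Matrix.det_fin_three, this]⟩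
  map_one' := by ext i j; fin_cases i <;> fin_cases j <;> simp [lowerRightMatrix]
  map_mul' γ δ := Subtype.ext (lowerRightMatrix_mul γ.1 δ.1)

theorem lowerRight_val (γ : SL(2, ℤ)) : (lowerRight γ).1 = lowerRightMatrix γ.1 := rfl

theorem exists_mul_eq_gcd (a b : ℤ) : ∃ γ : SL(2, ℤ),
    γ.1 0 0 * a + γ.1 0 1 * b = Int.gcd a b ∧ γ.1 1 0 * a + γ.1 1 1 * b = 0 := by
  rcases eq_or_ne (Int.gcd a b : ℤ) 0 with h | h
  · obtain ⟨rfl, rfl⟩ := Int.gcd_eq_zero_iff.1 (Int.natCast_eq_zero.1 h)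
    exact ⟨1, by simp⟩
  · obtain ⟨a', ha⟩ := Int.gcd_dvd_left (a := a) (b := b)
    obtain ⟨b', hb⟩ := Int.gcd_dvd_right (a := a) (b := b)
    have hg := Int.gcd_eq_gcd_ab a b
    -- The first row holds Bézout coefficients; the second is `(-b, a)` divided by the gcd, which
    -- makes the determinant 1.
    refine ⟨⟨!![Int.gcdA a b, Int.gcdB a b; -b', a'], ?_⟩, ?_, ?_⟩
    · rw [Matrix.det_fin_two_of]
      apply mul_left_cancel₀ h
      linear_combination -hg - Int.gcdA a b * ha - Int.gcdB a b * hb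
    · simp only [Matrix.of_apply, Matrix.cons_val', Matrix.cons_val_zero, Matrix.cons_val_one,
        Matrix.cons_val_fin_one]
      linear_combination -hg
    · simp only [Matrix.of_apply, Matrix.cons_val', Matrix.cons_val_zero, Matrix.cons_val_one,
        Matrix.cons_val_fin_one]
      linear_combination -b' * ha + a' * hb

theorem upperLeft_mul_apply (γ : SL(2, ℤ)) (g : SL(3, ℤ)) (j : Fin 3) :
    (upperLeft γ * g).1 0 j = γ.1 0 0 * g.1 0 j + γ.1 0 1 * g.1 1 j ∧
    (upperLeft γ * g).1 1 j = γ.1 1 0 * g.1 0 j + γ.1 1 1 * g.1 1 j ∧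
    (upperLeft γ * g).1 2 j = g.1 2 j := by
  rw [coe_mul, upperLeft_val]
  simp [upperLeftMatrix, Matrix.mul_apply, Fin.sum_univ_three]

theorem lowerRight_mul_apply (γ : SL(2, ℤ)) (g : SL(3, ℤ)) (j : Fin 3) :
    (lowerRight γ * g).1 0 j = g.1 0 j ∧
    (lowerRight γ * g).1 1 j = γ.1 0 0 * g.1 1 j + γ.1 0 1 * g.1 2 j ∧
    (lowerRight γ * g).1 2 j = γ.1 1 0 * g.1 1 j + γ.1 1 1 * g.1 2 j := by
  rw [coe_mul, lowerRight_val]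
  simp [lowerRightMatrix, Matrix.mul_apply, Fin.sum_univ_three]

/-- The matrix with rows `(1, c)` and `(0, 1)`. -/
def shear (c : ℤ) : SL(2, ℤ) := ⟨!![1, c; 0, 1], by simp⟩

/-- The last factor is a commutator of elementary matrices in positions (1,2) and (2,3), and gives
the corner entry. The first two factors, in this order, leave the corner 0. -/
theorem eq_mul_of_upper_unitriangular (g : SL(3, ℤ)) (h00 : g.1 0 0 = 1) (h10 : g.1 1 0 = 0)
    (h20 : g.1 2 0 = 0) (h11 : g.1 1 1 = 1) (h21 : g.1 2 1 = 0) (h22 : g.1 2 2 = 1) :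
    g = lowerRight (shear (g.1 1 2)) * upperLeft (shear (g.1 0 1)) *
      (upperLeft (shear 1) * lowerRight (shear (g.1 0 2)) * upperLeft (shear (-1)) *
        lowerRight (shear (-g.1 0 2))) := by
  apply Subtype.ext
  simp only [coe_mul, upperLeft_val, lowerRight_val]
  ext i j
  fin_cases i <;> fin_cases j <;>
    simp [upperLeftMatrix, lowerRightMatrix, shear, Matrix.mul_apply, Fin.sum_univ_three, *]

/-- Row reduction by the two blocks: three gcd steps make `g` upper triangular with the first two
diagonal entries nonnegative. Determinant 1 then makes it unitriangular. -/
theorem mem_of_block_mem (H : Subgroup SL(3, ℤ)) (hl : ∀ γ, upperLeft γ ∈ H)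
    (hr : ∀ γ, lowerRight γ ∈ H) (g : SL(3, ℤ)) : g ∈ H := by
  obtain ⟨γ₁, -, h₁⟩ := exists_mul_eq_gcd (g.1 1 0) (g.1 2 0)
  obtain ⟨g₁, hg₁⟩ : ∃ g₁, g₁ = lowerRight γ₁ * g := ⟨_, rfl⟩
  have a₁ : g₁.1 2 0 = 0 := by rw [hg₁, (lowerRight_mul_apply γ₁ g 0).2.2, h₁]
  rw [← H.mul_mem_cancel_left (hr γ₁), ← hg₁]
  obtain ⟨γ₂, h₂, h₂'⟩ := exists_mul_eq_gcd (g₁.1 0 0) (g₁.1 1 0)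
  obtain ⟨g₂, hg₂⟩ : ∃ g₂, g₂ = upperLeft γ₂ * g₁ := ⟨_, rfl⟩
  have a₂ : 0 ≤ g₂.1 0 0 := by
    rw [hg₂, (upperLeft_mul_apply γ₂ g₁ 0).1, h₂]; exact Int.natCast_nonneg _
  have b₂ : g₂.1 1 0 = 0 := by rw [hg₂, (upperLeft_mul_apply γ₂ g₁ 0).2.1, h₂']
  have c₂ : g₂.1 2 0 = 0 := by rw [hg₂, (upperLeft_mul_apply γ₂ g₁ 0).2.2, a₁]
  rw [← H.mul_mem_cancel_left (hl γ₂), ← hg₂]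
  obtain ⟨γ₃, h₃, h₃'⟩ := exists_mul_eq_gcd (g₂.1 1 1) (g₂.1 2 1)
  obtain ⟨g₃, hg₃⟩ : ∃ g₃, g₃ = lowerRight γ₃ * g₂ := ⟨_, rfl⟩
  have a₃ : 0 ≤ g₃.1 0 0 := by rw [hg₃, (lowerRight_mul_apply γ₃ g₂ 0).1]; exact a₂
  have b₃ : g₃.1 1 0 = 0 := by
    rw [hg₃, (lowerRight_mul_apply γ₃ g₂ 0).2.1, b₂, c₂, mul_zero, mul_zero, add_zero]
  have c₃ : g₃.1 2 0 = 0 := by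
    rw [hg₃, (lowerRight_mul_apply γ₃ g₂ 0).2.2, b₂, c₂, mul_zero, mul_zero, add_zero]
  have d₃ : 0 ≤ g₃.1 1 1 := by
    rw [hg₃, (lowerRight_mul_apply γ₃ g₂ 1).2.1, h₃]; exact Int.natCast_nonneg _
  have e₃ : g₃.1 2 1 = 0 := by rw [hg₃, (lowerRight_mul_apply γ₃ g₂ 1).2.2, h₃']
  rw [← H.mul_mem_cancel_left (hr γ₃), ← hg₃]
  have hdet : g₃.1 0 0 * (g₃.1 1 1 * g₃.1 2 2) = 1 := by
    have := g₃.2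
    rw [Matrix.det_fin_three, b₃, c₃, e₃] at this
    linarith
  have h00 : g₃.1 0 0 = 1 := Int.eq_one_of_mul_eq_one_right a₃ hdet
  have hdet' : g₃.1 1 1 * g₃.1 2 2 = 1 := by rwa [h00, one_mul] at hdet
  have h11 : g₃.1 1 1 = 1 := Int.eq_one_of_mul_eq_one_right d₃ hdet'
  have h22 : g₃.1 2 2 = 1 := by rwa [h11, one_mul] at hdet'
  rw [eq_mul_of_upper_unitriangular g₃ h00 b₃ c₃ h11 e₃ h22]
  exact H.mul_mem (H.mul_mem (hr _) (hl _))
    (H.mul_mem (H.mul_mem (H.mul_mem (hl _) (hr _)) (hl _)) (hr _))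

end Matrix.SpecialLinearGroup

theorem closure_elementaryGenerators :
    Subgroup.closure (elementaryGenerators : Set SL(3, ℤ)) = ⊤ := by
  have hmem (l : List SL(3, ℤ)) (hl : ∀ g ∈ l, g ∈ elementaryGenerators) :
      l.prod ∈ Subgroup.closure (elementaryGenerators : Set SL(3, ℤ)) :=
    list_prod_mem fun g hg => Subgroup.subset_closure (hl g hg)
  have hblock (φ : SL(2, ℤ) →* SL(3, ℤ))
      (hS : φ ModularGroup.S ∈ Subgroup.closure (elementaryGenerators : Set SL(3, ℤ)))
      (hT : φ ModularGroup.T ∈ Subgroup.closure (elementaryGenerators : Set SL(3, ℤ)))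
      (γ : SL(2, ℤ)) : φ γ ∈ Subgroup.closure (elementaryGenerators : Set SL(3, ℤ)) := by
    have h : Subgroup.closure {ModularGroup.S, ModularGroup.T} ≤
        (Subgroup.closure (elementaryGenerators : Set SL(3, ℤ))).comap φ := by
      rw [Subgroup.closure_le]
      rintro _ (rfl | rfl)
      exacts [hS, hT]
    rw [SpecialLinearGroup.SL2Z_generators] at h
    exact h (Subgroup.mem_top γ)
  rw [Subgroup.eq_top_iff']
  refine Matrix.SpecialLinearGroup.mem_of_block_mem _ (hblock _ ?_ ?_) (hblock _ ?_ ?_)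
  -- In `SL(2, ℤ)`, `S = T⁻¹ Tᵗ T⁻¹`; the same word is used in the other block.
  · convert hmem [(elementaryUpper 0)⁻¹, (elementaryUpper 0).transpose, (elementaryUpper 0)⁻¹]
      (by decide +kernel) using 1
    decide +kernel
  · convert hmem [elementaryUpper 0] (by decide +kernel) using 1
    decide +kernel
  · convert hmem [(elementaryUpper 2)⁻¹, (elementaryUpper 2).transpose, (elementaryUpper 2)⁻¹]
      (by decide +kernel) using 1
    decide +kernel
  · convert hmem [elementaryUpper 2] (by decide +kernel) using 1
    decide +kernel

/-! ### Spectral gap of a positive operator with `c A ≤ A ^ 2`. -/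

section operators

variable {H : Type*} [NormedAddCommGroup H] [InnerProductSpace ℂ H] [CompleteSpace H]

/-- A positive injective operator `A` with `c A ≤ A ^ 2` is bounded below by `c`. -/
theorem mul_norm_sq_le_inner_of_injective {A : H →L[ℂ] H} {c : ℝ} (hA : 0 ≤ A)
    (hc : 0 ≤ A ^ 2 - c • A) (hinj : ∀ x, A x = 0 → x = 0) (x : H) :
    c * ‖x‖ ^ 2 ≤ (inner ℂ (A x) x).re := by
  obtain ⟨R, hR0, hR⟩ : ∃ R : H →L[ℂ] H, 0 ≤ R ∧ R * R = A :=
    ⟨CFC.sqrt A, CFC.sqrt_nonneg A, CFC.sqrt_mul_sqrt_self A hA⟩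
  have hRsymm (x y : H) : inner ℂ (R x) y = inner ℂ x (R y) :=
    ((ContinuousLinearMap.nonneg_iff_isPositive R).1 hR0).inner_left_eq_inner_right x y
  have hRA (x : H) : R (R x) = A x := by rw [← hR]; rfl
  -- A vector orthogonal to the range of the square root `R` is killed by `R`, hence by `A`, hence
  -- is zero.
  have hdense : DenseRange R := by
    have h1 : (R : H →ₗ[ℂ] H).rangeᗮ = ⊥ := by
      rw [Submodule.eq_bot_iff]
      intro y hy
      refine hinj y ?_
      rw [← hRA]
      have : R y = 0 := by
        rw [← inner_self_eq_zero (𝕜 := ℂ), ← hRsymm, hRsymm, hRsymm]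
        exact (Submodule.mem_orthogonal' _ _).1 hy _ ⟨R y, rfl⟩
      rw [this, map_zero]
    have h2 := (Submodule.topologicalClosure_eq_top_iff).2 h1
    exact (Submodule.dense_iff_topologicalClosure_eq_top).2 h2
  refine hdense.induction_on (p := fun x => c * ‖x‖ ^ 2 ≤ (inner ℂ (A x) x).re) x ?_ ?_
  · exact isClosed_le (by fun_prop) (by fun_prop)
  -- At `R y` the claim reads `c ⟪A y, y⟫ ≤ ⟪A² y, y⟫`, which is the hypothesis; density does the
  -- rest.
  · intro y
    have h := ((ContinuousLinearMap.nonneg_iff_isPositive _).1 hc).re_inner_nonneg_left y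
    have h1 : (c • A) y = (c : ℂ) • A y := rfl
    have h2 : (A ^ 2) y = A (A y) := by rw [sq]; rfl
    rw [sub_apply, h1, h2, inner_sub_left, inner_smul_left, map_sub,
      Complex.conj_ofReal] at h
    have h3 : inner ℂ (A (A y)) y = inner ℂ (A (R y)) (R y) := by
      rw [← hRA (A y), hRsymm, hRsymm, hRA, ← hRA (R y), hRA y, hRsymm, hRA]
    have h4 : inner ℂ (A y) y = inner ℂ (R y) (R y) := by rw [← hRA, hRsymm]
    rw [h3, h4, inner_self_eq_norm_sq_to_K] at h
    simp only [RCLike.re_to_complex, Complex.coe_algebraMap, ← Complex.ofReal_pow,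
      ← Complex.ofReal_mul, Complex.ofReal_re] at h
    linarith

/-- The spectrum of a positive operator `A` with `c A ≤ A ^ 2` lies in `{0} ∪ [c, ∞)`. -/
theorem spectrum_subset_of_nonneg {A : H →L[ℂ] H} {c : ℝ} (hA : 0 ≤ A)
    (hc : 0 ≤ A ^ 2 - c • A) :
    spectrum ℂ A ⊆ ((↑) : ℝ → ℂ) '' ({0} ∪ Set.Ici c) := by
  intro z hz
  have hz' : z = (z.re : ℂ) := (IsSelfAdjoint.of_nonneg hA).mem_spectrum_eq_re hz
  rw [hz'] at hz
  have hr : z.re ∈ spectrum ℝ A := spectrum.of_algebraMap_mem ℂ hz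
  refine ⟨z.re, ?_, hz'.symm⟩
  have h0 : 0 ≤ z.re := spectrum_nonneg_of_nonneg hA hr
  -- By spectral mapping `z² - c z` lies in the spectrum of a positive operator.
  have h1 := spectrum.subset_polynomial_aeval A (Polynomial.X ^ 2 - c • Polynomial.X)
    (Set.mem_image_of_mem _ hr)
  simp only [Polynomial.eval_sub, Polynomial.eval_pow, Polynomial.eval_X, Polynomial.eval_smul,
    map_sub, map_pow, map_smul, Polynomial.aeval_X, smul_eq_mul] at h1
  have h2 := spectrum_nonneg_of_nonneg hc h1
  rcases h0.eq_or_lt with h | h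
  · exact Or.inl h.symm
  · refine Or.inr (le_of_mul_le_mul_right ?_ h)
    linarith

theorem re_inner_star_mul_self_apply (T : H →L[ℂ] H) (x : H) :
    (inner ℂ ((star T * T) x) x).re = ‖T x‖ ^ 2 :=
  (ContinuousLinearMap.apply_norm_sq_eq_inner_adjoint_left T x).symm

end operators

/-! ### The Laplacian in unitary representations. -/

section unitaryRep

variable {Γ : Type*} [Group Γ] {H : Type*} [NormedAddCommGroup H] [InnerProductSpace ℂ H]
  [CompleteSpace H] (π : Γ →* unitary (H →L[ℂ] H))

/-- The representation of the group algebra given by a unitary representation. -/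
def unitaryRepAlgHom : MonoidAlgebra ℝ Γ →ₐ[ℝ] (H →L[ℂ] H) :=
  MonoidAlgebra.lift ℝ (H →L[ℂ] H) Γ ((unitary (H →L[ℂ] H)).subtype.comp π)

theorem unitaryRepAlgHom_apply (x : MonoidAlgebra ℝ Γ) :
    unitaryRepAlgHom π x = unitaryRepOperator π x := rfl

theorem unitaryRepAlgHom_single (g : Γ) (c : ℝ) :
    unitaryRepAlgHom π (MonoidAlgebra.single g c) = c • (π g : H →L[ℂ] H) :=
  MonoidAlgebra.lift_single _ _ _

theorem unitaryRepAlgHom_groupAlgebraStar (x : MonoidAlgebra ℝ Γ) :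
    unitaryRepAlgHom π (groupAlgebraStar x) = star (unitaryRepAlgHom π x) := by
  rw [← groupAlgebraStarLinear_apply]
  induction x using MonoidAlgebra.induction_linear with
  | zero => simp
  | add x y hx hy => rw [map_add, map_add, map_add, hx, hy, star_add]
  | single g c =>
    rw [groupAlgebraStarLinear_apply, groupAlgebraStar_single, unitaryRepAlgHom_single,
      unitaryRepAlgHom_single, map_inv, ← Unitary.star_eq_inv, Unitary.coe_star, star_smul,
      star_trivial c]

theorem unitaryRepAlgHom_sum_squares_nonneg {ι : Type*} (T : Finset ι)
    (b : ι → MonoidAlgebra ℝ Γ) :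
    0 ≤ unitaryRepAlgHom π (∑ i ∈ T, groupAlgebraStar (b i) * b i) := by
  rw [map_sum]
  refine Finset.sum_nonneg fun i _ => ?_
  rw [map_mul, unitaryRepAlgHom_groupAlgebraStar]
  exact star_mul_self_nonneg _

theorem unitaryRepAlgHom_laplaceElement_apply (S : Finset Γ) (x : H) :
    unitaryRepAlgHom π (laplaceElement S) x = ∑ s ∈ S, (x - (π s : H →L[ℂ] H) x) := by
  have h : unitaryRepAlgHom π (laplaceElement S) = ∑ s ∈ S, (1 - (π s : H →L[ℂ] H)) := by
    rw [laplaceElement, map_sub, AlgHom.commutes, map_sum, Finset.sum_sub_distrib,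
      Finset.sum_const]
    simp only [unitaryRepAlgHom_single, one_smul, map_natCast, nsmul_one]
  rw [h, sum_apply]
  rfl

theorem norm_unitary_apply (u : unitary (H →L[ℂ] H)) (x : H) : ‖(u : H →L[ℂ] H) x‖ = ‖x‖ := by
  have h : star (u : H →L[ℂ] H) * (u : H →L[ℂ] H) = 1 := Unitary.coe_star_mul_self u
  exact (ContinuousLinearMap.norm_map_iff_adjoint_comp_self _).2 h x

/-- For each `s`, `(1 - s)^* (1 - s) = (1 - s) + (1 - s⁻¹)`, and inversion permutes `S`. -/
theorem laplaceElement_eq_sum_squares {S : Finset Γ} (hS : ∀ s ∈ S, s⁻¹ ∈ S) :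
    laplaceElement S + laplaceElement S =
      ∑ s ∈ S, groupAlgebraStar (1 - MonoidAlgebra.single s 1) *
        (1 - MonoidAlgebra.single s (1 : ℝ)) := by
  have h1 (s : Γ) : groupAlgebraStar (1 - MonoidAlgebra.single s 1) *
      (1 - MonoidAlgebra.single s (1 : ℝ)) =
      (1 - MonoidAlgebra.single s 1) + (1 - MonoidAlgebra.single s⁻¹ 1) := by
    rw [← groupAlgebraStarLinear_apply, map_sub, MonoidAlgebra.one_def]
    simp only [groupAlgebraStarLinear_apply, groupAlgebraStar_single, inv_one, sub_mul, mul_sub,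
      MonoidAlgebra.single_mul_single, one_mul, mul_one, inv_mul_cancel]
    abel
  have h2 : ∑ s ∈ S, MonoidAlgebra.single s⁻¹ (1 : ℝ) = ∑ s ∈ S, MonoidAlgebra.single s (1 : ℝ) :=
    Finset.sum_nbij' (·⁻¹) (·⁻¹) hS hS (by simp) (by simp) (by simp)
  simp only [h1, Finset.sum_add_distrib, Finset.sum_sub_distrib, h2, Finset.sum_const]
  rw [laplaceElement, map_natCast, nsmul_one]

theorem unitaryRepAlgHom_laplaceElement_nonneg {S : Finset Γ} (hS : ∀ s ∈ S, s⁻¹ ∈ S) :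
    0 ≤ unitaryRepAlgHom π (laplaceElement S) := by
  have h := unitaryRepAlgHom_sum_squares_nonneg π S fun s => 1 - MonoidAlgebra.single s (1 : ℝ)
  rw [← laplaceElement_eq_sum_squares hS, map_add, ← two_smul ℝ] at h
  have h2 := smul_nonneg (by norm_num : (0 : ℝ) ≤ 1 / 2) h
  rwa [smul_smul, show (1 / 2 * 2 : ℝ) = 1 by norm_num, one_smul] at h2

/-- Pairing with `x` gives `2 ⟪π(Δ) x, x⟫ = ∑ ‖x - π(s) x‖²`, so every summand vanishes. -/
theorem apply_eq_of_laplaceElement_apply_eq_zero {S : Finset Γ} (hS : ∀ s ∈ S, s⁻¹ ∈ S) {x : H}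
    (hx : unitaryRepAlgHom π (laplaceElement S) x = 0) {s : Γ} (hs : s ∈ S) :
    (π s : H →L[ℂ] H) x = x := by
  have h := congrArg (fun T => (inner ℂ (unitaryRepAlgHom π T x) x).re)
    (laplaceElement_eq_sum_squares hS)
  have h1 (s : Γ) : (inner ℂ (unitaryRepAlgHom π (groupAlgebraStar (1 - MonoidAlgebra.single s 1) *
      (1 - MonoidAlgebra.single s (1 : ℝ))) x) x).re = ‖x - (π s : H →L[ℂ] H) x‖ ^ 2 := by
    rw [map_mul, unitaryRepAlgHom_groupAlgebraStar, map_sub, map_one, unitaryRepAlgHom_single,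
      one_smul]
    exact re_inner_star_mul_self_apply (1 - (π s : H →L[ℂ] H)) x
  simp only [map_add, map_sum, add_apply, hx, add_zero, inner_zero_left,
    Complex.zero_re, sum_apply, sum_inner, Complex.re_sum, h1] at h
  have h2 := (Finset.sum_eq_zero_iff_of_nonneg fun s _ => sq_nonneg _).1 h.symm s hs
  exact (sub_eq_zero.1 (norm_eq_zero.1 (pow_eq_zero_iff two_ne_zero |>.1 h2))).symm

theorem unitaryRepAlgHom_sq_sub_nonneg {S : Finset Γ} {c : ℝ} {n : ℕ}
    {b : Fin n → MonoidAlgebra ℝ Γ}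
    (hb : laplaceElement S ^ 2 - c • laplaceElement S = ∑ i, groupAlgebraStar (b i) * b i) :
    0 ≤ unitaryRepAlgHom π (laplaceElement S) ^ 2 - c • unitaryRepAlgHom π (laplaceElement S) := by
  rw [← map_pow, ← map_smul, ← map_sub, hb]
  exact unitaryRepAlgHom_sum_squares_nonneg π _ _

theorem spectrum_laplaceElement_subset {S : Finset Γ} (hS : ∀ s ∈ S, s⁻¹ ∈ S) {c : ℝ} {n : ℕ}
    {b : Fin n → MonoidAlgebra ℝ Γ}
    (hb : laplaceElement S ^ 2 - c • laplaceElement S = ∑ i, groupAlgebraStar (b i) * b i) :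
    spectrum ℂ (unitaryRepOperator π (laplaceElement S)) ⊆
      ((↑) : ℝ → ℂ) '' ({0} ∪ Set.Ici c) :=
  spectrum_subset_of_nonneg (unitaryRepAlgHom_laplaceElement_nonneg π hS)
    (unitaryRepAlgHom_sq_sub_nonneg π hb)

theorem norm_unitaryRepOperator_randomWalkElement_le (S : Finset Γ) :
    ‖unitaryRepOperator π (randomWalkElement S)‖ ≤ 1 := by
  rw [← unitaryRepAlgHom_apply, randomWalkElement, map_smul, map_sum, norm_smul]
  have h : ‖∑ s ∈ S, unitaryRepAlgHom π (MonoidAlgebra.single s (1 : ℝ))‖ ≤ S.card := by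
    refine (norm_sum_le _ _).trans ?_
    rw [Finset.cast_card]
    refine Finset.sum_le_sum fun s _ => ?_
    rw [unitaryRepAlgHom_single, one_smul]
    exact ContinuousLinearMap.opNorm_le_bound _ zero_le_one fun x => by
      rw [norm_unitary_apply, one_mul]
  rw [Real.norm_of_nonneg (by positivity)]
  refine (mul_le_mul_of_nonneg_left h (by positivity)).trans ?_
  rw [one_div]
  exact inv_mul_le_one

/-- The random walk element is `1 - Δ / |S|`, so the gap carries over by spectral mapping; the lower
end -1 comes from the operator norm being at most 1. -/
theorem spectrum_randomWalkElement_subset {S : Finset Γ} (hS : ∀ s ∈ S, s⁻¹ ∈ S)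
    (hS' : S.Nonempty) {c : ℝ} {n : ℕ} {b : Fin n → MonoidAlgebra ℝ Γ}
    (hb : laplaceElement S ^ 2 - c • laplaceElement S = ∑ i, groupAlgebraStar (b i) * b i) :
    spectrum ℂ (unitaryRepOperator π (randomWalkElement S)) ⊆
      ((↑) : ℝ → ℂ) '' (Set.Icc (-1) (1 - c / S.card) ∪ {1}) := by
  intro z hz
  have hcard : (0 : ℝ) < S.card := by exact_mod_cast hS'.card_pos
  have h1 : laplaceElement S = algebraMap ℝ _ (S.card : ℝ) - (S.card : ℝ) • randomWalkElement S := by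
    rw [laplaceElement, randomWalkElement, smul_smul, mul_one_div_cancel hcard.ne', one_smul]
  have h2 : unitaryRepOperator π (laplaceElement S) = Polynomial.aeval
      (unitaryRepOperator π (randomWalkElement S))
        (Polynomial.C (S.card : ℂ) - Polynomial.C (S.card : ℂ) * Polynomial.X) := by
    rw [← unitaryRepAlgHom_apply, h1, map_sub, AlgHom.commutes, map_smul]
    simp only [map_sub, map_mul, Polynomial.aeval_X, map_natCast,
      unitaryRepAlgHom_apply, Nat.cast_smul_eq_nsmul, nsmul_eq_mul]
  have h3 := spectrum.subset_polynomial_aeval _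
    (Polynomial.C (S.card : ℂ) - Polynomial.C (S.card : ℂ) * Polynomial.X)
    (Set.mem_image_of_mem _ hz)
  rw [← h2] at h3
  simp only [Polynomial.eval_sub, Polynomial.eval_mul, Polynomial.eval_C, Polynomial.eval_X] at h3
  obtain ⟨t, ht, hzt⟩ := spectrum_laplaceElement_subset π hS hb h3
  have hz1 : z = ((1 - t / S.card : ℝ) : ℂ) := by
    have : (S.card : ℂ) ≠ 0 := by exact_mod_cast hcard.ne'
    push_cast
    rw [hzt]
    field_simp
    ring
  have hz2 : |1 - t / S.card| ≤ 1 := by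
    -- On the zero space the spectrum is empty; elsewhere the norm bounds it.
    rcases subsingleton_or_nontrivial H with _ | _
    · rw [spectrum.of_subsingleton] at hz
      exact absurd hz (Set.notMem_empty _)
    · have h4 := (spectrum.norm_le_norm_of_mem hz).trans
        (norm_unitaryRepOperator_randomWalkElement_le π S)
      rwa [hz1, Complex.norm_real] at h4
  refine ⟨1 - t / S.card, ?_, hz1.symm⟩
  rcases ht with rfl | ht
  · exact Or.inr (by simp)
  · refine Or.inl ⟨(abs_le.1 hz2).1, ?_⟩
    have := div_le_div_of_nonneg_right (Set.mem_Ici.1 ht) hcard.le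
    linarith

end unitaryRep

/-! ### Property (T) and the conclusion. -/

/-- A group is Kazhdan if the square of its Laplacian minus a positive multiple of the Laplacian
is a sum of squares. -/
theorem hasPropertyT_of_sum_squares.{u, v} {Γ : Type u} [Group Γ] {S : Finset Γ}
    (hS : ∀ s ∈ S, s⁻¹ ∈ S) (hgen : Subgroup.closure (S : Set Γ) = ⊤) {c : ℝ} (hc : 0 < c) {n : ℕ}
    {b : Fin n → MonoidAlgebra ℝ Γ}
    (hb : laplaceElement S ^ 2 - c • laplaceElement S = ∑ i, groupAlgebraStar (b i) * b i) :
    HasPropertyT.{u, v} Γ := by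
  -- This `ε` satisfies `|S| ε < c`, so an almost invariant `x` has `‖π(Δ) x‖ < c ‖x‖`, against
  -- `π(Δ) ≥ c`.
  refine ⟨S, c / (S.card + 1), by positivity, fun H _ _ _ π ⟨x, hx0, hx⟩ => ?_⟩
  by_contra! hinv
  -- A vector killed by the Laplacian is fixed by `S`, hence by the group that `S` generates.
  have hinj (y : H) (hy : unitaryRepAlgHom π (laplaceElement S) y = 0) : y = 0 := by
    by_contra hy0
    obtain ⟨g, hg⟩ := hinv y hy0
    refine hg ?_
    clear hg
    have hmem : g ∈ Subgroup.closure (S : Set Γ) := hgen ▸ Subgroup.mem_top g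
    induction hmem using Subgroup.closure_induction with
    | mem s hs => exact apply_eq_of_laplaceElement_apply_eq_zero π hS hy hs
    | one => rw [map_one]; rfl
    | mul g h _ _ hg hh =>
      rw [map_mul]
      exact (congrArg (π g : H →L[ℂ] H) hh).trans hg
    | inv g _ hg =>
      have h : (π g⁻¹ : H →L[ℂ] H) ((π g : H →L[ℂ] H) y) = y := by
        have h' : ((π g⁻¹ * π g : unitary (H →L[ℂ] H)) : H →L[ℂ] H) y = y := by
          rw [← map_mul, inv_mul_cancel, map_one]; rfl
        exact h'
      rwa [hg] at h
  have h1 := mul_norm_sq_le_inner_of_injective (unitaryRepAlgHom_laplaceElement_nonneg π hS)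
    (unitaryRepAlgHom_sq_sub_nonneg π hb) hinj x
  have hxn : 0 < ‖x‖ := norm_pos_iff.2 hx0
  have h2 : ‖unitaryRepAlgHom π (laplaceElement S) x‖ ≤ S.card * (c / (S.card + 1) * ‖x‖) := by
    rw [unitaryRepAlgHom_laplaceElement_apply, ← nsmul_eq_mul]
    refine (norm_sum_le _ _).trans (Finset.sum_le_card_nsmul _ _ _ fun s hs => ?_)
    rw [norm_sub_rev]
    exact (hx s hs).le
  have h3 := (Complex.re_le_norm _).trans
    (norm_inner_le_norm (𝕜 := ℂ) (unitaryRepAlgHom π (laplaceElement S) x) x)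
  have h4 : S.card * (c / (S.card + 1) * ‖x‖) < c * ‖x‖ := by
    rw [← mul_assoc]
    refine mul_lt_mul_of_pos_right ?_ hxn
    rw [mul_div_assoc', div_lt_iff₀ (by positivity)]
    linarith
  have h5 := mul_lt_mul_of_pos_right (h2.trans_lt h4) hxn
  nlinarith

theorem inv_mem_elementaryGenerators :
    ∀ s ∈ elementaryGenerators, s⁻¹ ∈ elementaryGenerators := by
  decide +kernel

end

theorem mainTheorem1 :
    -- the sum of squares decomposition in the real group algebra
    (∃ (n : ℕ) (b : Fin n → MonoidAlgebra ℝ (Matrix.SpecialLinearGroup (Fin 3) ℤ)),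
      n ≤ 121 ∧
      (∀ i, (b i).coeff.support.card ≤ 121 ∧
        ((b i).coeff.support : Set (Matrix.SpecialLinearGroup (Fin 3) ℤ)) ⊆
          wordBall elementaryGenerators 2) ∧
      laplaceElement elementaryGenerators ^ 2 -
          (1 / 6 : ℝ) • laplaceElement elementaryGenerators =
        ∑ i, groupAlgebraStar (b i) * b i) ∧
    -- property (T)
    HasPropertyT.{0, w} (Matrix.SpecialLinearGroup (Fin 3) ℤ) ∧
    -- the spectral gaps in every unitary representation
    (∀ (H : Type w) [NormedAddCommGroup H] [InnerProductSpace ℂ H] [CompleteSpace H]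
      (π : Matrix.SpecialLinearGroup (Fin 3) ℤ →* unitary (H →L[ℂ] H)),
      spectrum ℂ (unitaryRepOperator π (laplaceElement elementaryGenerators)) ⊆
          ((↑) : ℝ → ℂ) '' ({0} ∪ Set.Ici (1 / 6)) ∧
        spectrum ℂ (unitaryRepOperator π (randomWalkElement elementaryGenerators)) ⊆
          ((↑) : ℝ → ℂ) '' (Set.Icc (-1) (1 - 1 / 72) ∪ {1})) := by
  obtain ⟨b, hsupp, hb⟩ := exists_sum_squares
  refine ⟨⟨84, b, by norm_num, fun i => ⟨?_, ?_⟩, hb⟩,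
    hasPropertyT_of_sum_squares inv_mem_elementaryGenerators closure_elementaryGenerators
      (by norm_num) hb, fun H _ _ _ π =>
    ⟨spectrum_laplaceElement_subset π inv_mem_elementaryGenerators hb, ?_⟩⟩
  · refine (Finset.card_le_card (hsupp i)).trans ((Finset.card_insert_le _ _).trans ?_)
    have := Finset.card_image_le (s := Finset.range 84) (f := wordElement)
    rw [Finset.card_range] at this
    omega
  · intro g hg
    rcases Finset.mem_insert.1 (hsupp i hg) with rfl | h
    · exact one_mem_wordBall _ _
    · obtain ⟨k, -, rfl⟩ := Finset.mem_image.1 h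
      exact wordElement_mem_wordBall k
  · have h := spectrum_randomWalkElement_subset π inv_mem_elementaryGenerators
      (Finset.card_pos.1 (by rw [card_elementaryGenerators]; norm_num)) hb
    rw [card_elementaryGenerators] at h
    norm_num at h ⊢
    exact h
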